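/- A collection of hypermaps on a finite set $X$ of $n$ points is a pair $(\sigma,\alpha)$ of permutations of $X$; it is a hypermap if the group $\langle\sigma,\alpha\rangle$ is transitive on $X$. Let $z(\pi)$ denote the number of cycles of a permutation $\pi$, fixed points included. The genus $g(\sigma,\alpha)$ of a hypermap is given by $n+2-2g(\sigma,\alpha)=z(\sigma)+z(\alpha)+z(\alpha^{-1}\sigma)$. A permutation $\theta$ is a refinement of $\gamma$ if $\theta$ maps the set of points of each cycle of $\gamma$ to itself and, for each cycle $\gamma_i$ of $\gamma$, the restriction $\theta_i$ of $\theta$ to the points of $\gamma_i$ satisfies $g(\theta_i,\gamma_i)=0$. A spanning hypertree of a hypermap $(\sigma,\alpha)$ is a hypermap $(\sigma,\theta)$ such that $\theta$ is a refinement of $\alpha$, $z(\theta^{-1}\sigma)=1$ and $g(\sigma,\theta)=0$. The reciprocal of $(\sigma,\alpha)$ is $(\alpha,\sigma)$. For $m\ge 0$ let $(\sigma_m,\alpha_m)$ be the ladder map with $m$ bounded faces. Its underlying graph has the vertices $(i,r)$ with $0\le i\le m$ and $r\in\{0,1\}$, the vertical edges joining $(i,0)$ and $(i,1)$ for $0\le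 i\le m$, and the horizontal edges joining $(i,r)$ and $(i+1,r)$ for $0\le i<m$ and $r\in\{0,1\}$, drawn in the plane with straight edges. Its points are the $6m+2$ half-edges; $\sigma_m$ sends each half-edge to the next one counterclockwise around its vertex, and $\alpha_m$ exchanges the two halves of each edge. **Theorem.** Let $T(m)$ be the number of spanning hypertrees of the reciprocal $(\alpha_m,\sigma_m)$ of $(\sigma_m,\alpha_m)$. Then, as formal power series, $$\sum_{m\ge 0} T(m)\,x^m=\frac{(1-2x)^2}{1-8x+8x^2}.$$ -/

import Mathlib

open Equiv

/-- A collection of hypermaps on the point set `X`: a pair of permutations of `X`. -/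
structure HypermapCollection (X : Type*) where
  σ : Perm X
  α : Perm X

/-- The number `z(π)` of cycles of `π`, fixed points included. -/
noncomputable def numCycles {X : Type*} (π : Perm X) : ℕ :=
  Nat.card (Quotient (Perm.SameCycle.setoid π))

namespace HypermapCollection

variable {X : Type*}

/-- The number `κ(σ, α)` of connected components: orbits of the group generated by `σ`, `α`. -/
noncomputable def numComponents (H : HypermapCollection X) : ℕ :=
  Nat.card (MulAction.orbitRel.Quotient (Subgroup.closure ({H.σ, H.α} : Set (Perm X))) X)

/-- A hypermap is a connected collection of hypermaps. -/
def IsHypermap (H : HypermapCollection X) : Prop :=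
  H.numComponents = 1

/-- The faces are the cycles of `α⁻¹σ`. -/
noncomputable def numFaces (H : HypermapCollection X) : ℕ :=
  numCycles (H.α⁻¹ * H.σ)

/-- The genus, determined by `n + 2 - 2g = z(σ) + z(α) + z(α⁻¹σ)` when `(σ, α)` is a hypermap on
`n` points. On a collection of `κ` hypermaps it is the sum of the genera of the components,
whence the summand `2κ` in place of `2`. -/
noncomputable def genus (H : HypermapCollection X) : ℚ :=
  ((Nat.card X : ℚ) + 2 * H.numComponents - numCycles H.σ - numCycles H.α - H.numFaces) / 2

/-- The reciprocal `(α, σ)` of `(σ, α)`. -/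
def reciprocal (H : HypermapCollection X) : HypermapCollection X where
  σ := H.α
  α := H.σ

end HypermapCollection

/-- `θ` is a refinement of `γ`: for every cycle of `γ`, here the cycle through `x`, the
permutation `θ` maps the set of points of the cycle to itself, and the restrictions of `θ` and
`γ` to that set form a hypermap of genus zero. -/
def IsRefinement {X : Type*} (θ γ : Perm X) : Prop :=
  ∀ x : X, ∃ h : ∀ y, γ.SameCycle x (θ y) ↔ γ.SameCycle x y,
    (HypermapCollection.mk (θ.subtypePerm h)
      (γ.subtypePerm fun _ => Perm.sameCycle_apply_right)).genus = 0

namespace HypermapCollection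

variable {X : Type*}

/-- `(σ, θ)` is a spanning hypertree of `(σ, α)`: `θ` refines `α`, and `(σ, θ)` is a hypermap
that is unicellular and has genus zero. -/
def IsSpanningHypertree (H : HypermapCollection X) (θ : Perm X) : Prop :=
  IsRefinement θ H.α ∧ (mk H.σ θ).IsHypermap ∧ (mk H.σ θ).numFaces = 1 ∧ (mk H.σ θ).genus = 0

/-- The number of spanning hypertrees. -/
noncomputable def numSpanningHypertrees (H : HypermapCollection X) : ℕ :=
  Nat.card {θ : Perm X // H.IsSpanningHypertree θ}

end HypermapCollection

/-- The points (half-edges) of the ladder with `m` squares side by side. Its vertices are the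
pairs `(i, r)`, with `0 ≤ i ≤ m` the column and `r` the row (`true` for the top row).
* `vert i r` is the end at `(i, r)` of the vertical edge between `(i, true)` and `(i, false)`;
* `right i r` and `left i r` are the ends at `(i, r)` and at `(i + 1, r)`, respectively,
  of the horizontal edge between these two vertices. -/
inductive LadderPoint (m : ℕ) : Type
  | vert (i : Fin (m + 1)) (r : Bool)
  | right (i : Fin m) (r : Bool)
  | left (i : Fin m) (r : Bool)
  deriving DecidableEq, Fintype

namespace LadderPoint

variable {m : ℕ}

/-- Whether the point is in the top row. -/
def row : LadderPoint m → Bool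
  | vert _ r => r
  | right _ r => r
  | left _ r => r

/-- The other end of the edge. -/
def opposite : LadderPoint m → LadderPoint m
  | vert i r => vert i (!r)
  | right i r => left i r
  | left i r => right i r

/-- At each vertex, the next point in the cyclic order right, left, vertical, skipping those
that do not exist. This is the counterclockwise order at the vertices of the top row and the
clockwise order at those of the bottom row. -/
def next : LadderPoint m → LadderPoint m
  | right i r => if 0 < i.1 then left ⟨i.1 - 1, by omega⟩ r else vert ⟨i.1, by omega⟩ r
  | left i r => vert ⟨i.1 + 1, by omega⟩ r
  | vert i r =>
    if h : i.1 < m then right ⟨i.1, h⟩ r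
    else if h' : 0 < i.1 then left ⟨i.1 - 1, by omega⟩ r
    else vert i r

/-- At each vertex, the next point in the cyclic order right, vertical, left, skipping those
that do not exist. -/
def prev : LadderPoint m → LadderPoint m
  | right i r => vert ⟨i.1, by omega⟩ r
  | left i r => if h : i.1 + 1 < m then right ⟨i.1 + 1, h⟩ r else vert ⟨i.1 + 1, by omega⟩ r
  | vert i r =>
    if h' : 0 < i.1 then left ⟨i.1 - 1, by omega⟩ r
    else if h : i.1 < m then right ⟨i.1, h⟩ r
    else vert i r

theorem opposite_opposite (p : LadderPoint m) : p.opposite.opposite = p := by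
  cases p <;> simp [opposite]

theorem row_next (p : LadderPoint m) : p.next.row = p.row := by
  cases p <;> grind [next, row]

theorem row_prev (p : LadderPoint m) : p.prev.row = p.row := by
  cases p <;> grind [prev, row]

theorem prev_next (p : LadderPoint m) : p.next.prev = p := by
  rcases p with ⟨i, r⟩ | ⟨i, r⟩ | ⟨i, r⟩ <;> grind [next, prev]

theorem next_prev (p : LadderPoint m) : p.prev.next = p := by
  rcases p with ⟨i, r⟩ | ⟨i, r⟩ | ⟨i, r⟩ <;> grind [next, prev]

end LadderPoint

/-- The ladder map `(σ_m, α_m)` with `m` bounded faces, drawn in the plane: `σ_m` goes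
counterclockwise around each vertex, `α_m` exchanges the two ends of each edge. -/
def ladderMap (m : ℕ) : HypermapCollection (LadderPoint m) where
  σ :=
    { toFun := fun p => if p.row then p.next else p.prev
      invFun := fun p => if p.row then p.prev else p.next
      left_inv := fun p => by
        by_cases h : p.row <;>
          simp [h, LadderPoint.row_next, LadderPoint.row_prev, LadderPoint.prev_next,
            LadderPoint.next_prev]
      right_inv := fun p => by
        by_cases h : p.row <;>
          simp [h, LadderPoint.row_next, LadderPoint.row_prev, LadderPoint.prev_next,
            LadderPoint.next_prev] }
  α :=
    { toFun := LadderPoint.opposite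
      invFun := LadderPoint.opposite
      left_inv := LadderPoint.opposite_opposite
      right_inv := LadderPoint.opposite_opposite }

/-! A spanning hypertree of the reciprocal is a refinement `θ` of the vertex rotation `σ` for which
the pair of `θ` and the edge involution `α` is connected, unicellular and of genus zero. For a
connected pair this amounts to `z(θ) + z(α) = n + 1`: the incidence graph whose vertices are the
cycles of `θ` and of `α` and whose edges are the points is a tree. Unicellularity then follows
(`numCycles_inv_mul_eq_one`), so only connectedness and a cycle count remain.

Vertices of the ladder have degree at most three. A refinement is therefore any permutation
preserving each vertex, except that a vertex of degree three excludes its inverse rotation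
(`isRefinement_iff`). Hence `θ` is a sequence of local choices, one `Column` per rung, with the
directions missing at the two ends held fixed (`numSpanningHypertrees_eq`).

Cutting the ladder after a column leaves two horizontal edges. In a forest each component must reach
one of them, and all that matters further right is whether the two are joined or separate.
Connectedness is expressed by two-colourings of the edges. The Euler characteristic bounds the
number of cycles of each part, with equality exactly for forests, so the global cycle count splits
into conditions on single columns (`isForest_appendColumn_iff`, `isTreeColumns_appendColumn_iff`).
Finite enumeration gives the transfer matrix with rows (4, 1) and (8, 4). Its trace and determinant
are both 8, whence the denominator `1 - 8x + 8x²`. -/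

/-! ### Counting cycles by the dimension of the space of invariant functions -/

section Invariants

variable {X : Type*}

/-- The functions that are constant on the cycles of `π`. -/
def invariantFunctions (π : Perm X) : Submodule ℚ (X → ℚ) where
  carrier := {f | ∀ x, f (π x) = f x}
  add_mem' := fun hf hg x => by simp [hf x, hg x]
  zero_mem' := fun _ => rfl
  smul_mem' := fun c f hf x => by simp [hf x]

theorem apply_eq_of_sameCycle {Y : Type*} {π : Perm X} {f : X → Y} (hf : ∀ x, f (π x) = f x)
    {x y : X} (h : π.SameCycle x y) : f x = f y := by
  have hinv : ∀ x, f (π⁻¹ x) = f x := fun x => by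
    rw [← hf (π⁻¹ x), Perm.inv_def, apply_symm_apply]
  obtain ⟨k, rfl⟩ := h
  induction k using Int.induction_on with
  | zero => simp
  | succ i ih => rw [add_comm, zpow_add, zpow_one, Perm.mul_apply, hf, ← ih]
  | pred i ih =>
    rw [show -(i : ℤ) - 1 = -1 + -(i : ℤ) by ring, zpow_add, zpow_neg_one, Perm.mul_apply, hinv,
      ← ih]

/-- Invariant functions are functions on the set of cycles. -/
def invariantFunctionsEquiv (π : Perm X) :
    invariantFunctions π ≃ₗ[ℚ] (Quotient (Perm.SameCycle.setoid π) → ℚ) where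
  toFun f := fun q => Quotient.lift f.1 (fun _ _ h => apply_eq_of_sameCycle f.2 h) q
  invFun g := ⟨fun x => g (Quotient.mk _ x), fun x => congrArg g
    (Quotient.sound (show π.SameCycle (π x) x from Perm.sameCycle_apply_left.2 (.refl _ _)))⟩
  left_inv f := rfl
  right_inv g := by ext q; induction q using Quotient.inductionOn; rfl
  map_add' f g := by ext q; induction q using Quotient.inductionOn; rfl
  map_smul' c g := by ext q; induction q using Quotient.inductionOn; rfl

theorem finrank_invariantFunctions [Finite X] (π : Perm X) :
    Module.finrank ℚ (invariantFunctions π) = numCycles π := by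
  classical
  have := Fintype.ofFinite (Quotient (Perm.SameCycle.setoid π))
  rw [(invariantFunctionsEquiv π).finrank_eq, Module.finrank_fintype_fun_eq_card, numCycles,
    Nat.card_eq_fintype_card]

/-- If `x` and `y` lie in different cycles of `π`, these are merged in `swap x y * π`. -/
theorem invariant_swap_mul_iff [DecidableEq X] [Finite X] {Y : Type*} {π : Perm X} {x y : X}
    (h : ¬ π.SameCycle x y) (f : X → Y) :
    (∀ z, f ((swap x y * π) z) = f z) ↔ (∀ z, f (π z) = f z) ∧ f x = f y := by
  have hswap : f x = f y → ∀ z, f (swap x y z) = f z := fun hxy z => by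
    rw [swap_apply_def]; split_ifs with h1 h2
    · rw [h1, hxy]
    · rw [h2, hxy]
    · rfl
  constructor
  · intro hf
    have hxy : f x = f y := by
      -- The orbit of `x` under `π` never meets `y`, so the swap acts on it only on returning to
      -- `x`. At `π⁻¹ x` the product lands on `y`, which yields `f x = f y`.
      have key : ∀ j : ℕ, f ((π ^ j) x) = f x := by
        intro j
        induction j with
        | zero => rfl
        | succ j ih =>
          by_cases hx : (π ^ (j + 1)) x = x
          · rw [hx]
          have hy : (π ^ (j + 1)) x ≠ y := fun hy => h ⟨(j + 1 : ℕ), by rw [zpow_natCast, hy]⟩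
          have := hf ((π ^ j) x)
          rw [Perm.mul_apply, ← Perm.mul_apply π, ← pow_succ', swap_apply_of_ne_of_ne hx hy] at this
          rw [this, ih]
      have hs : π.SameCycle x (π⁻¹ x) := ⟨-1, by simp⟩
      obtain ⟨j, hj⟩ := hs.exists_nat_pow_eq
      have := hf (π⁻¹ x)
      rw [Perm.mul_apply, Perm.inv_def, apply_symm_apply, swap_apply_left, ← Perm.inv_def, ← hj,
        key] at this
      exact this.symm
    refine ⟨fun z => ?_, hxy⟩
    rw [← hf z, Perm.mul_apply, hswap hxy]
  · rintro ⟨hf, hxy⟩ z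
    rw [Perm.mul_apply, hswap hxy, hf]

/-- The functions that take the same value at `x` and `y`. -/
def agreeAt (x y : X) : Submodule ℚ (X → ℚ) :=
  LinearMap.ker (LinearMap.proj (R := ℚ) (φ := fun _ : X => ℚ) x - LinearMap.proj y)

theorem mem_agreeAt {x y : X} {f : X → ℚ} : f ∈ agreeAt x y ↔ f x = f y := by
  simp [agreeAt, sub_eq_zero]

theorem finrank_le_finrank_inf_agreeAt_add_one [Finite X] (V : Submodule ℚ (X → ℚ)) (x y : X) :
    Module.finrank ℚ V ≤ Module.finrank ℚ (V ⊓ agreeAt x y : Submodule ℚ (X → ℚ)) + 1 := by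
  let φ : (X → ℚ) →ₗ[ℚ] ℚ :=
    LinearMap.proj (R := ℚ) (φ := fun _ : X => ℚ) x - LinearMap.proj y
  have h1 := LinearMap.finrank_range_add_finrank_ker (φ.domRestrict V)
  have h2 : Module.finrank ℚ (LinearMap.range (φ.domRestrict V)) ≤ 1 := by
    simpa using Submodule.finrank_le (LinearMap.range (φ.domRestrict V))
  have h3 : Module.finrank ℚ (LinearMap.ker (φ.domRestrict V)) ≤
      Module.finrank ℚ (V ⊓ agreeAt x y : Submodule ℚ (X → ℚ)) := by
    have : (LinearMap.ker (φ.domRestrict V)).map V.subtype ≤ V ⊓ agreeAt x y := by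
      rintro _ ⟨f, hf, rfl⟩
      exact ⟨f.2, hf⟩
    rw [← Submodule.finrank_map_subtype_eq]
    exact Submodule.finrank_mono this
  omega

/-- Merging two cycles imposes one linear equation `f x = f y` on invariant functions. The indicator
of the cycle of `x` violates it, so the dimension drops by exactly one. -/
theorem numCycles_swap_mul [DecidableEq X] [Finite X] {π : Perm X} {x y : X}
    (h : ¬ π.SameCycle x y) : numCycles (swap x y * π) + 1 = numCycles π := by
  have hinf : invariantFunctions (swap x y * π) = invariantFunctions π ⊓ agreeAt x y := by
    ext f
    rw [Submodule.mem_inf, mem_agreeAt]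
    exact invariant_swap_mul_iff h f
  rw [← finrank_invariantFunctions, ← finrank_invariantFunctions, hinf]
  refine le_antisymm (Submodule.finrank_lt_finrank_of_lt (lt_of_le_of_ne inf_le_left ?_))
    (finrank_le_finrank_inf_agreeAt_add_one _ x y)
  intro heq
  classical
  have hmem : (fun z => if π.SameCycle x z then (1 : ℚ) else 0) ∈ invariantFunctions π := by
    intro z
    simp only [Perm.sameCycle_apply_right]
  rw [← heq, Submodule.mem_inf, mem_agreeAt] at hmem
  simp [h, Perm.SameCycle.refl] at hmem

theorem numCycles_one [Finite X] : numCycles (1 : Perm X) = Nat.card X := by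
  refine Nat.card_congr ⟨Quotient.lift id fun x y h => ?_, Quotient.mk _, fun q => ?_, fun _ => rfl⟩
  · exact Perm.sameCycle_one.1 h
  · induction q using Quotient.inductionOn; rfl

theorem numCycles_inv (π : Perm X) : numCycles π⁻¹ = numCycles π := by
  refine Nat.card_congr (Quotient.congr (Equiv.refl X) fun x y => ?_)
  exact Perm.sameCycle_inv

/-- If only constant functions are invariant under `θ` and `α`, then
`z(θ) + z(α) ≤ |X| + 1`. -/
theorem numCycles_add_numCycles_le [Finite X] [Nonempty X] {θ α : Perm X}
    (hc : ∀ f : X → ℚ, (∀ x, f (θ x) = f x) → (∀ x, f (α x) = f x) → ∀ x y, f x = f y) :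
    numCycles θ + numCycles α ≤ Nat.card X + 1 := by
  have := Fintype.ofFinite X
  -- The sum of the two spaces has dimension at most `|X|`, and their intersection consists of
  -- constants.
  have h1 := Submodule.finrank_sup_add_finrank_inf_eq (invariantFunctions θ) (invariantFunctions α)
  have h2 := Submodule.finrank_le (invariantFunctions θ ⊔ invariantFunctions α)
  rw [Module.finrank_fintype_fun_eq_card, ← Nat.card_eq_fintype_card] at h2
  have h3 : Module.finrank ℚ
      (invariantFunctions θ ⊓ invariantFunctions α : Submodule ℚ (X → ℚ)) ≤ 1 := by
    refine (Submodule.finrank_mono (t := ℚ ∙ (fun _ : X => (1 : ℚ))) ?_).trans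
      (finrank_span_le_card _ |>.trans (by simp))
    rintro f ⟨hf, hg⟩
    obtain ⟨x₀⟩ := ‹Nonempty X›
    refine Submodule.mem_span_singleton.2 ⟨f x₀, funext fun x => ?_⟩
    simpa using hc f hf hg x₀ x
  rw [finrank_invariantFunctions, finrank_invariantFunctions] at h1
  omega

/-- A tree-like pair of permutations is unicellular. -/
theorem numCycles_inv_mul_eq_one [Finite X] [Nonempty X] {θ α : Perm X}
    (hc : ∀ f : X → ℚ, (∀ x, f (θ x) = f x) → (∀ x, f (α x) = f x) → ∀ x y, f x = f y)
    (hz : numCycles θ + numCycles α = Nat.card X + 1) : numCycles (θ⁻¹ * α) = 1 := by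
  classical
  have := Fintype.ofFinite X
  induction hn : α.support.card using Nat.strong_induction_on generalizing θ α with
  | _ n ih =>
  by_cases hα : α = 1
  · subst hα
    rw [numCycles_one] at hz
    rw [mul_one, numCycles_inv]
    omega
  obtain ⟨x, hx⟩ : ∃ x, α x ≠ x := by
    by_contra! h
    exact hα (Perm.ext h)
  -- Multiplying both `θ` and `α` by the same transposition leaves `θ⁻¹ * α` unchanged. It splits
  -- `x` off its cycle in `α` and merges two cycles of `θ`, so the total number of cycles is kept
  -- while the support of `α` shrinks.
  set α' := swap x (α x) * α with hα'
  have hαα' : α = swap x (α x) * α' := by rw [hα', ← mul_assoc, swap_mul_self, one_mul]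
  have hfix : α' x = x := by simp [hα']
  have hnot : ¬ α'.SameCycle x (α x) := fun h => hx
    ((h.eq_of_left hfix).symm)
  have hzα : numCycles α + 1 = numCycles α' := by
    conv_lhs => rw [hαα']
    exact numCycles_swap_mul hnot
  have hinvα : ∀ f : X → ℚ, (∀ z, f (α z) = f z) ↔ (∀ z, f (α' z) = f z) ∧ f x = f (α x) := by
    intro f
    conv_lhs => rw [hαα']
    exact invariant_swap_mul_iff hnot f
  by_cases hs : θ.SameCycle x (α x)
  · exfalso
    -- If `θ` already joined `x` and `α x`, the pair `θ`, `α'` would still be connected, with one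
    -- cycle more than the bound permits.
    have := numCycles_add_numCycles_le (θ := θ) (α := α') fun f hf hf' =>
      hc f hf ((hinvα f).2 ⟨hf', apply_eq_of_sameCycle hf hs⟩)
    omega
  · have hzθ := numCycles_swap_mul hs
    have hlt : α'.support.card < n := by
      rw [← hn]
      exact Perm.card_support_swap_mul hx
    have := ih _ hlt (θ := swap x (α x) * θ) (α := α') (fun f hf hf' => by
      rw [invariant_swap_mul_iff hs] at hf
      exact hc f hf.1 ((hinvα f).2 ⟨hf', hf.2⟩)) (by omega) rfl
    rw [mul_inv_rev, swap_inv, mul_assoc, ← hαα'] at this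
    exact this

end Invariants

/-! ### Connectedness and the tree criterion -/

namespace HypermapCollection

variable {X : Type*}

/-- Connectedness in terms of colourings of the points. -/
theorem isHypermap_iff [Finite X] [Nonempty X] (H : HypermapCollection X) :
    H.IsHypermap ↔ ∀ f : X → Bool, (∀ x, f (H.σ x) = f x) → (∀ x, f (H.α x) = f x) →
      ∀ x y, f x = f y := by
  classical
  set G := Subgroup.closure ({H.σ, H.α} : Set (Perm X)) with hG
  have hne : Nonempty (MulAction.orbitRel.Quotient G X) :=
    ‹Nonempty X›.map (Quotient.mk _)
  rw [IsHypermap, numComponents, Nat.card_eq_one_iff_unique]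
  constructor
  · rintro ⟨hsub, -⟩ f hσ hα x y
    have hg : ∀ g ∈ G, ∀ x, f (g x) = f x := by
      intro g hgG
      induction hgG using Subgroup.closure_induction with
      | mem g hg =>
        rcases hg with rfl | rfl
        · exact hσ
        · exact hα
      | one => exact fun _ => rfl
      | mul a b _ _ ha hb => exact fun x => by rw [Perm.mul_apply, ha, hb]
      | inv a _ ha => exact fun x => by rw [← ha (a⁻¹ x), Perm.inv_def, apply_symm_apply]
    have hxy : (Quotient.mk _ x : MulAction.orbitRel.Quotient G X) = Quotient.mk _ y :=
      Subsingleton.elim _ _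
    obtain ⟨g, rfl⟩ := MulAction.orbitRel_apply.1 (Quotient.exact hxy)
    exact hg g.1 g.2 y
  · intro h
    refine ⟨⟨fun p q => ?_⟩, hne⟩
    induction p using Quotient.inductionOn with | _ x
    induction q using Quotient.inductionOn with | _ y
    have hmem : ∀ g ∈ ({H.σ, H.α} : Set (Perm X)), ∀ z,
        (Quotient.mk _ (g z) : MulAction.orbitRel.Quotient G X) = Quotient.mk _ z :=
      fun g hg z => Quotient.sound
        (MulAction.orbitRel_apply.2 ⟨⟨g, Subgroup.subset_closure hg⟩, rfl⟩)
    have := h (fun z => decide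
      ((Quotient.mk _ z : MulAction.orbitRel.Quotient G X) = Quotient.mk _ x))
      (fun z => by rw [hmem _ (by simp)]) (fun z => by rw [hmem _ (by simp)]) x y
    simp only [decide_true] at this
    exact (of_decide_eq_true this.symm).symm

theorem isHypermap_of_forall_sameCycle [Finite X] [Nonempty X] (H : HypermapCollection X)
    (h : ∀ x y, H.α.SameCycle x y) : H.IsHypermap :=
  H.isHypermap_iff.2 fun _ _ hα x y => apply_eq_of_sameCycle hα (h x y)

/-- Among the connected pairs, those that are unicellular of genus zero are characterized by their
numbers of cycles. -/
theorem isHypermap_and_numFaces_and_genus_iff [Finite X] [Nonempty X] (σ θ : Perm X) :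
    ((mk σ θ).IsHypermap ∧ (mk σ θ).numFaces = 1 ∧ (mk σ θ).genus = 0) ↔
      (mk σ θ).IsHypermap ∧ numCycles θ + numCycles σ = Nat.card X + 1 := by
  refine and_congr_right fun hc => ?_
  have hcomp : (mk σ θ).numComponents = 1 := hc
  constructor
  · rintro ⟨hf, hg⟩
    rw [genus, hcomp, hf] at hg
    have : ((numCycles θ + numCycles σ : ℕ) : ℚ) = ((Nat.card X + 1 : ℕ) : ℚ) := by
      push_cast at hg ⊢; linarith
    exact_mod_cast this
  · intro hz
    have hf : (mk σ θ).numFaces = 1 := by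
      refine numCycles_inv_mul_eq_one (fun f hθ hσ x y => ?_) hz
      -- A rational function is reduced to a two-colouring by comparing it with its value at `x`.
      have := (isHypermap_iff _).1 hc (fun z => decide (f z = f x)) (fun z => by simp [hσ])
        (fun z => by simp [hθ]) x y
      simp only [decide_true] at this
      exact (of_decide_eq_true this.symm).symm
    refine ⟨hf, ?_⟩
    have hz' : (numCycles θ : ℚ) + numCycles σ = Nat.card X + 1 := by exact_mod_cast hz
    rw [genus, hcomp, hf]
    push_cast
    linarith

end HypermapCollection

/-! ### Counting cycles by representatives -/

section Representatives

variable {X : Type*}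

/-- The cycles are counted by their elements of smallest rank. -/
theorem numCycles_eq_card_minimal {ι : Type*} [LinearOrder ι] [Finite X] (π : Perm X) (f : X → ι)
    (hf : ∀ x y, π.SameCycle x y → f x = f y → x = y) :
    numCycles π = Nat.card {x : X // ∀ y, π.SameCycle x y → f x ≤ f y} := by
  refine (Nat.card_congr (Equiv.ofBijective
    (fun x : {x : X // ∀ y, π.SameCycle x y → f x ≤ f y} =>
      (Quotient.mk (Perm.SameCycle.setoid π) x.1)) ⟨?_, ?_⟩)).symm
  · rintro ⟨x, hx⟩ ⟨y, hy⟩ hxy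
    have h : π.SameCycle x y := Quotient.exact hxy
    exact Subtype.ext (hf x y h (le_antisymm (hx y h) (hy x h.symm)))
  · intro q
    induction q using Quotient.inductionOn with | _ x
    obtain ⟨y, hy, hmin⟩ := Set.exists_min_image {y | π.SameCycle x y} f (Set.toFinite _)
      ⟨x, .refl _ _⟩
    exact ⟨⟨y, fun z hz => hmin z (Perm.SameCycle.trans hy hz)⟩, Quotient.sound hy.symm⟩

theorem numCycles_permCongr {Y : Type*} (e : X ≃ Y) (π : Perm X) :
    numCycles (e.permCongr π) = numCycles π := by
  refine (Nat.card_congr (Quotient.congr e fun x y => ?_)).symm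
  have hpow : ∀ k : ℤ, ((e.permCongr π) ^ k) (e x) = e ((π ^ k) x) := fun k => by
    have : (e.permCongr π) ^ k = e.permCongr (π ^ k) :=
      (map_zpow (Equiv.permCongrHom e) π k).symm
    rw [this]; simp
  refine exists_congr fun k => ?_
  rw [hpow, e.apply_eq_iff_eq]

theorem numCycles_eq_one_of_forall_sameCycle [Nonempty X] {π : Perm X}
    (h : ∀ x y, π.SameCycle x y) : numCycles π = 1 := by
  rw [numCycles, Nat.card_eq_one_iff_unique]
  refine ⟨⟨fun p q => ?_⟩, ‹Nonempty X›.map (Quotient.mk _)⟩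
  induction p using Quotient.inductionOn
  induction q using Quotient.inductionOn
  exact Quotient.sound (h _ _)

end Representatives

/-! ### Refinements of permutations with short cycles -/

section SmallCycles

variable {X : Type*}

/-- The number of cycles of a permutation of `Fin n`, in a form that can be evaluated. -/
def countCycles {n : ℕ} (π : Perm (Fin n)) : ℕ :=
  (Finset.univ.filter fun d => ∀ e, π.SameCycle d e → d ≤ e).card

theorem numCycles_eq_countCycles {n : ℕ} (π : Perm (Fin n)) : numCycles π = countCycles π := by
  rw [numCycles_eq_card_minimal π id (fun _ _ _ h => h), Nat.card_eq_fintype_card,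
    Fintype.card_subtype]
  rfl

/-- Since `γ` is a single cycle, the equation is the genus-zero condition. On at most three points
every partition is noncrossing, and the only way to fail is to traverse a block of three backwards;
this is checked case by case. -/
theorem countCycles_add_countCycles_iff {n : ℕ} (h0 : 0 < n) (hn : n ≤ 3) (γ θ : Perm (Fin n))
    (h : ∀ x y, γ.SameCycle x y) :
    countCycles θ + countCycles (γ⁻¹ * θ) = n + 1 ↔ ¬ (n = 3 ∧ θ = γ⁻¹) := by
  interval_cases n <;> revert γ θ <;> decide +kernel

/-- Over a single cycle of length at most three, every permutation forms a hypermap of genus zero,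
except the inverse of a cycle of length three. -/
theorem genus_eq_zero_iff_of_forall_sameCycle [Finite X] [Nonempty X] (hX : Nat.card X ≤ 3)
    {γ θ : Perm X} (h : ∀ x y, γ.SameCycle x y) :
    (HypermapCollection.mk θ γ).genus = 0 ↔ ¬ (Nat.card X = 3 ∧ θ = γ⁻¹) := by
  have hcomp : (HypermapCollection.mk θ γ).numComponents = 1 :=
    HypermapCollection.isHypermap_of_forall_sameCycle _ h
  let e := Finite.equivFin X
  have h' : ∀ x y, (e.permCongr γ).SameCycle x y := fun x y => by
    obtain ⟨k, hk⟩ := h (e.symm x) (e.symm y)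
    refine ⟨k, ?_⟩
    rw [show (e.permCongr γ) ^ k = e.permCongr (γ ^ k) from
      (map_zpow (Equiv.permCongrHom e) γ k).symm]
    simp [hk]
  have key := countCycles_add_countCycles_iff Nat.card_pos hX (e.permCongr γ) (e.permCongr θ) h'
  have hmul : (e.permCongr γ)⁻¹ * e.permCongr θ = e.permCongr (γ⁻¹ * θ) := by
    rw [← Equiv.permCongrHom_coe, map_mul, map_inv]
  have hinv : (e.permCongr θ = (e.permCongr γ)⁻¹) ↔ θ = γ⁻¹ := by
    rw [← Equiv.permCongrHom_coe, ← map_inv]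
    exact (Equiv.permCongrHom e).injective.eq_iff
  rw [hmul, ← numCycles_eq_countCycles, ← numCycles_eq_countCycles, numCycles_permCongr,
    numCycles_permCongr, hinv] at key
  rw [← key, HypermapCollection.genus, hcomp, numCycles_eq_one_of_forall_sameCycle h,
    HypermapCollection.numFaces, ← @Nat.cast_inj ℚ]
  push_cast
  constructor <;> intro hh <;> linarith

/-- The refinements of a permutation all of whose cycles have length at most three. -/
theorem isRefinement_iff [Finite X] {γ θ : Perm X}
    (hγ : ∀ x, Nat.card {y // γ.SameCycle x y} ≤ 3) :
    IsRefinement θ γ ↔ ∀ x, γ.SameCycle x (θ x) ∧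
      ¬ (Nat.card {y // γ.SameCycle x y} = 3 ∧ ∀ y, γ.SameCycle x y → θ y = γ⁻¹ y) := by
  have hsub : ∀ x (y z : {y // γ.SameCycle x y}),
      (γ.subtypePerm fun _ => Perm.sameCycle_apply_right (x := x)).SameCycle y z := fun x y z => by
    rw [Perm.sameCycle_subtypePerm]
    exact y.2.symm.trans z.2
  have hne : ∀ x, Nonempty {y // γ.SameCycle x y} := fun x => ⟨⟨x, .refl _ _⟩⟩
  have key : ∀ x (h : ∀ y, γ.SameCycle x (θ y) ↔ γ.SameCycle x y),
      (HypermapCollection.mk (θ.subtypePerm h)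
        (γ.subtypePerm fun _ => Perm.sameCycle_apply_right)).genus = 0 ↔
      ¬ (Nat.card {y // γ.SameCycle x y} = 3 ∧ ∀ y, γ.SameCycle x y → θ y = γ⁻¹ y) := by
    intro x h
    have := hne x
    rw [genus_eq_zero_iff_of_forall_sameCycle (hγ x) (hsub x)]
    refine not_congr (and_congr_right fun _ => ?_)
    rw [Perm.ext_iff, Subtype.forall]
    refine forall₂_congr fun y hy => ?_
    rw [Subtype.ext_iff]
    rfl
  constructor
  · intro hr x
    obtain ⟨h, hg⟩ := hr x
    exact ⟨(h x).2 (.refl _ _), (key x h).1 hg⟩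
  · intro hr x
    have h : ∀ y, γ.SameCycle x (θ y) ↔ γ.SameCycle x y := fun y =>
      ⟨fun hy => hy.trans (hr y).1.symm, fun hy => hy.trans (hr y).1⟩
    exact ⟨h, (key x h).2 (hr x).2⟩

end SmallCycles

/-! ### Local description by columns and directions -/

/-- A permutation of the three directions left, vertical, right, for each of the two vertices of
a column. -/
abbrev Column := Bool → Perm (Fin 3)

/-- The colouring of the directions left, vertical, right by `a`, `v`, `b` is constant on the cycles
of `s`. -/
def Respects (s : Perm (Fin 3)) (a v b : Bool) : Prop := ∀ d, ![a, v, b] (s d) = ![a, v, b] d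

instance (s : Perm (Fin 3)) (a v b : Bool) : Decidable (Respects s a v b) :=
  inferInstanceAs (Decidable (∀ _, _))

/-- The counterclockwise rotation of the directions, at a vertex with all three of them. -/
def vertexRotation (r : Bool) : Perm (Fin 3) := if r then finRotate 3 else (finRotate 3)⁻¹

/-- The colours `v i` of the vertical edges and `e r i` of the horizontal edges left of column `i`
respect the permutations at the vertices of the columns. -/
def Compatible {m : ℕ} (s : Fin (m + 1) → Column) (e : Bool → ℕ → Bool) (v : ℕ → Bool) : Prop :=
  ∀ (i : Fin (m + 1)) (r : Bool), Respects (s i r) (e r i) (v i) (e r (i + 1))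

/-- All compatible colourings of the edges of the ladder are constant. -/
def ConnectedColumns {m : ℕ} (s : Fin (m + 1) → Column) : Prop :=
  ∀ e v, Compatible s e v →
    (∀ i ≤ m, v i = v 0) ∧ ∀ i r, 1 ≤ i → i ≤ m → e r i = v 0

/-- The directions missing at the two ends of the ladder are fixed. -/
def FixesEnds {m : ℕ} (s : Fin (m + 1) → Column) : Prop :=
  ∀ r, s 0 r 0 = 0 ∧ s (Fin.last m) r 2 = 2

namespace LadderPoint

variable {m : ℕ}

/-- The column of the vertex. -/
def col : LadderPoint m → Fin (m + 1)
  | vert i _ => i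
  | right i _ => i.castSucc
  | left i _ => i.succ

/-- The direction at the vertex: `0` for left, `1` for vertical, `2` for right. -/
def dir : LadderPoint m → Fin 3
  | vert _ _ => 1
  | right _ _ => 2
  | left _ _ => 0

theorem ext_coord {p q : LadderPoint m} (hc : p.col = q.col) (hr : p.row = q.row)
    (hd : p.dir = q.dir) : p = q := by
  cases p <;> cases q <;> simp_all [col, row, dir]

theorem exists_coord (i : Fin (m + 1)) (r : Bool) (d : Fin 3) :
    (∃ p : LadderPoint m, p.col = i ∧ p.row = r ∧ p.dir = d) ↔
      (d = 0 → i ≠ 0) ∧ (d = 2 → i ≠ Fin.last m) := by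
  constructor
  · rintro ⟨p, rfl, rfl, rfl⟩
    cases p <;> simp [col, dir, Fin.succ_ne_zero, Fin.castSucc_ne_last]
  · rintro ⟨h0, h2⟩
    fin_cases d
    · obtain ⟨j, rfl⟩ := Fin.exists_succ_eq.2 (h0 rfl)
      exact ⟨left j r, rfl, rfl, rfl⟩
    · exact ⟨vert i r, rfl, rfl, rfl⟩
    · obtain ⟨j, rfl⟩ := Fin.exists_castSucc_eq.2 (h2 rfl)
      exact ⟨right j r, rfl, rfl, rfl⟩

instance : Nonempty (LadderPoint m) := ⟨vert 0 true⟩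

/-- The points, listed by kind. -/
def equivSum : LadderPoint m ≃ (Fin (m + 1) × Bool) ⊕ (Fin m × Bool) ⊕ (Fin m × Bool) where
  toFun
    | vert i r => .inl (i, r)
    | right i r => .inr (.inl (i, r))
    | left i r => .inr (.inr (i, r))
  invFun
    | .inl (i, r) => vert i r
    | .inr (.inl (i, r)) => right i r
    | .inr (.inr (i, r)) => left i r
  left_inv p := by cases p <;> rfl
  right_inv q := by rcases q with _ | _ | _ <;> rfl

theorem card_eq : Nat.card (LadderPoint m) = 6 * m + 2 := by
  rw [Nat.card_congr equivSum]
  simp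
  ring

/-- The edge of a point. -/
def edge : LadderPoint m → Fin (m + 1) ⊕ (Fin m × Bool)
  | vert i _ => .inl i
  | right i r => .inr (i, r)
  | left i r => .inr (i, r)

end LadderPoint

open LadderPoint

variable {m : ℕ}

theorem sameCycle_ladderMap_α (p q : LadderPoint m) :
    (ladderMap m).α.SameCycle p q ↔ p.edge = q.edge := by
  constructor
  · refine apply_eq_of_sameCycle fun p => ?_
    cases p <;> rfl
  · intro h
    by_cases hpq : p = q
    · exact hpq ▸ .refl _ _
    · refine ⟨1, ?_⟩
      rw [zpow_one]
      change p.opposite = q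
      cases p <;> cases q <;> simp_all [edge, opposite, ← Bool.eq_not]

theorem numCycles_ladderMap_α (m : ℕ) : numCycles (ladderMap m).α = 3 * m + 1 := by
  have hsurj : Function.Surjective (edge : LadderPoint m → _) := by
    rintro (i | ⟨i, r⟩)
    · exact ⟨vert i true, rfl⟩
    · exact ⟨right i r, rfl⟩
  have : Perm.SameCycle.setoid (ladderMap m).α = Setoid.ker edge :=
    Setoid.ext fun p q => sameCycle_ladderMap_α p q
  rw [numCycles, this, Nat.card_congr (Setoid.quotientKerEquivOfSurjective _ hsurj)]
  simp
  ring

theorem ladderMap_σ_apply (p : LadderPoint m) :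
    (ladderMap m).σ p = if p.row then p.next else p.prev := rfl

theorem col_ladderMap_σ (p : LadderPoint m) : ((ladderMap m).σ p).col = p.col := by
  rw [ladderMap_σ_apply]
  rcases p with ⟨i, r⟩ | ⟨i, r⟩ | ⟨i, r⟩ <;> cases r <;> grind [next, prev, col, row]

theorem row_ladderMap_σ (p : LadderPoint m) : ((ladderMap m).σ p).row = p.row := by
  rw [ladderMap_σ_apply]
  split_ifs
  · exact row_next p
  · exact row_prev p

theorem dir_ladderMap_σ (p : LadderPoint m) (h0 : p.col ≠ 0) (hm : p.col ≠ Fin.last m) :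
    ((ladderMap m).σ p).dir = vertexRotation p.row p.dir := by
  rw [ladderMap_σ_apply]
  have h0' : 0 < p.col.1 := Nat.pos_of_ne_zero fun h => h0 (Fin.ext h)
  have hm' : p.col.1 < m := lt_of_le_of_ne (Nat.le_of_lt_succ p.col.2) fun h => hm (Fin.ext h)
  rcases p with ⟨i, r⟩ | ⟨i, r⟩ | ⟨i, r⟩ <;> cases r <;>
    simp_all [next, prev, col, row, dir, vertexRotation]
  all_goals rfl

theorem sameCycle_ladderMap_σ (p q : LadderPoint m) :
    (ladderMap m).σ.SameCycle p q ↔ p.col = q.col ∧ p.row = q.row := by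
  constructor
  · exact fun h => ⟨apply_eq_of_sameCycle col_ladderMap_σ h,
      apply_eq_of_sameCycle row_ladderMap_σ h⟩
  · have key : ∀ p : LadderPoint m, (ladderMap m).σ.SameCycle p (vert p.col p.row) := by
      have step : ∀ p q : LadderPoint m, (ladderMap m).σ p = q → (ladderMap m).σ.SameCycle p q :=
        fun p q h => ⟨1, h⟩
      intro p
      rcases p with ⟨i, r⟩ | ⟨i, r⟩ | ⟨i, r⟩
      · exact .refl _ _
      · cases r
        · exact step _ _ rfl
        · refine (step _ _ ?_).symm
          simp [ladderMap_σ_apply, next, row, col]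
      · cases r
        · refine (step _ _ ?_).symm
          simp [ladderMap_σ_apply, prev, row, col]
        · exact step _ _ rfl
    rintro ⟨hc, hr⟩
    refine (key p).trans ?_
    rw [hc, hr]
    exact (key q).symm

theorem injective_dir_vertex (p : LadderPoint m) : Function.Injective
    (fun q : {q // (ladderMap m).σ.SameCycle p q} => q.1.dir) := by
  intro q q' h
  have hq := (sameCycle_ladderMap_σ _ _).1 q.2
  have hq' := (sameCycle_ladderMap_σ _ _).1 q'.2
  exact Subtype.ext (ext_coord (hq.1.symm.trans hq'.1) (hq.2.symm.trans hq'.2) h)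

theorem card_vertex_le (p : LadderPoint m) :
    Nat.card {q // (ladderMap m).σ.SameCycle p q} ≤ 3 :=
  (Nat.card_le_card_of_injective _ (injective_dir_vertex p)).trans_eq (Nat.card_fin 3)

theorem card_vertex_eq_three_iff (p : LadderPoint m) :
    Nat.card {q // (ladderMap m).σ.SameCycle p q} = 3 ↔ p.col ≠ 0 ∧ p.col ≠ Fin.last m := by
  have hsurj : Nat.card {q // (ladderMap m).σ.SameCycle p q} = 3 ↔ Function.Surjective
      (fun q : {q // (ladderMap m).σ.SameCycle p q} => q.1.dir) := by
    constructor
    · intro h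
      exact ((Nat.bijective_iff_injective_and_card _).2 ⟨injective_dir_vertex p, by simpa using h⟩).2
    · intro h
      simpa using Nat.card_eq_of_bijective _ ⟨injective_dir_vertex p, h⟩
  rw [hsurj]
  constructor
  · intro h
    constructor
    · obtain ⟨⟨q, hq⟩, hd⟩ := h 0
      have := (exists_coord p.col p.row 0).1
        ⟨q, ((sameCycle_ladderMap_σ _ _).1 hq).1.symm, ((sameCycle_ladderMap_σ _ _).1 hq).2.symm, hd⟩
      exact this.1 rfl
    · obtain ⟨⟨q, hq⟩, hd⟩ := h 2
      have := (exists_coord p.col p.row 2).1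
        ⟨q, ((sameCycle_ladderMap_σ _ _).1 hq).1.symm, ((sameCycle_ladderMap_σ _ _).1 hq).2.symm, hd⟩
      exact this.2 rfl
  · rintro ⟨h0, hm⟩ d
    obtain ⟨q, hc, hr, hd⟩ := (exists_coord p.col p.row d).2 ⟨fun _ => h0, fun _ => hm⟩
    exact ⟨⟨q, (sameCycle_ladderMap_σ _ _).2 ⟨hc.symm, hr.symm⟩⟩, hd⟩

/-- `θ` preserves the vertices of the ladder and acts on the directions at them by `s`. -/
def Represents (s : Fin (m + 1) → Column) (θ : Perm (LadderPoint m)) : Prop :=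
  ∀ p, (θ p).col = p.col ∧ (θ p).row = p.row ∧ (θ p).dir = s p.col p.row p.dir

theorem Represents.unique_right {s : Fin (m + 1) → Column} {θ θ' : Perm (LadderPoint m)}
    (h : Represents s θ) (h' : Represents s θ') : θ = θ' :=
  Perm.ext fun p => ext_coord ((h p).1.trans (h' p).1.symm) ((h p).2.1.trans (h' p).2.1.symm)
    ((h p).2.2.trans (h' p).2.2.symm)

theorem FixesEnds.apply_eq_self {s : Fin (m + 1) → Column} (hs : FixesEnds s) {i : Fin (m + 1)}
    {r : Bool} {d : Fin 3} (h : ¬ ∃ p : LadderPoint m, p.col = i ∧ p.row = r ∧ p.dir = d) :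
    s i r d = d := by
  rw [exists_coord] at h
  by_cases h0 : d = 0 ∧ i = 0
  · rw [h0.1, h0.2, (hs r).1]
  · obtain ⟨hd, hi⟩ : d = 2 ∧ i = Fin.last m := by tauto
    rw [hd, hi, (hs r).2]

theorem Represents.unique_left {s s' : Fin (m + 1) → Column} {θ : Perm (LadderPoint m)}
    (hs : FixesEnds s) (hs' : FixesEnds s') (h : Represents s θ) (h' : Represents s' θ) :
    s = s' := by
  refine funext fun i => funext fun r => Perm.ext fun d => ?_
  by_cases hp : ∃ p : LadderPoint m, p.col = i ∧ p.row = r ∧ p.dir = d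
  · obtain ⟨p, rfl, rfl, rfl⟩ := hp
    exact (h p).2.2.symm.trans (h' p).2.2
  · rw [hs.apply_eq_self hp, hs'.apply_eq_self hp]

theorem FixesEnds.exists_represents {s : Fin (m + 1) → Column} (hs : FixesEnds s) :
    ∃ θ, Represents s θ := by
  have hex : ∀ p : LadderPoint m, ∃ q : LadderPoint m,
      q.col = p.col ∧ q.row = p.row ∧ q.dir = s p.col p.row p.dir := by
    intro p
    -- A missing target direction would be fixed by `s`. By injectivity the source direction would
    -- equal it, yet the source exists.
    by_contra hq
    have h1 := hs.apply_eq_self hq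
    rw [(s p.col p.row).apply_eq_iff_eq] at h1
    exact hq ⟨p, rfl, rfl, h1.symm⟩
  choose f hf using hex
  have hinj : Function.Injective f := by
    intro p q h
    have hp := hf p
    rw [h] at hp
    have hc := hp.1.symm.trans (hf q).1
    have hr := hp.2.1.symm.trans (hf q).2.1
    have hd := hp.2.2.symm.trans (hf q).2.2
    rw [hc, hr, (s _ _).apply_eq_iff_eq] at hd
    exact ext_coord hc hr hd
  exact ⟨Equiv.ofBijective f (Finite.injective_iff_bijective.1 hinj), hf⟩

theorem exists_represents_of_forall {θ : Perm (LadderPoint m)}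
    (h : ∀ p, (θ p).col = p.col ∧ (θ p).row = p.row) :
    ∃ s, FixesEnds s ∧ Represents s θ := by
  classical
  have hex : ∀ (i : Fin (m + 1)) (r : Bool), ∃ s : Perm (Fin 3), ∀ d,
      (∀ p : LadderPoint m, p.col = i → p.row = r → p.dir = d → s d = (θ p).dir) ∧
      ((¬ ∃ p : LadderPoint m, p.col = i ∧ p.row = r ∧ p.dir = d) → s d = d) := by
    intro i r
    -- Existing directions follow `θ`; missing ones are fixed. No collision arises between the two
    -- kinds, because `θ` maps points of the vertex to points of the vertex.
    have hf : ∀ d, ∃ d' : Fin 3,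
        (∀ p : LadderPoint m, p.col = i → p.row = r → p.dir = d → d' = (θ p).dir) ∧
        ((¬ ∃ p : LadderPoint m, p.col = i ∧ p.row = r ∧ p.dir = d) → d' = d) := by
      intro d
      by_cases hp : ∃ p : LadderPoint m, p.col = i ∧ p.row = r ∧ p.dir = d
      · obtain ⟨p, hp⟩ := hp
        refine ⟨(θ p).dir, fun q hc hr hd => ?_, fun hn => (hn ⟨p, hp⟩).elim⟩
        rw [ext_coord (hp.1.trans hc.symm) (hp.2.1.trans hr.symm) (hp.2.2.trans hd.symm)]
      · exact ⟨d, fun q hc hr hd => (hp ⟨q, hc, hr, hd⟩).elim, fun _ => rfl⟩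
    choose f hf using hf
    have hinj : Function.Injective f := by
      intro d d' hdd
      by_cases hp : ∃ p : LadderPoint m, p.col = i ∧ p.row = r ∧ p.dir = d <;>
      by_cases hp' : ∃ p : LadderPoint m, p.col = i ∧ p.row = r ∧ p.dir = d'
      · obtain ⟨p, hc, hr, hd⟩ := hp
        obtain ⟨p', hc', hr', hd'⟩ := hp'
        rw [(hf d).1 p hc hr hd, (hf d').1 p' hc' hr' hd'] at hdd
        have := θ.injective (ext_coord (by rw [(h p).1, (h p').1, hc, hc'])
          (by rw [(h p).2, (h p').2, hr, hr']) hdd)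
        rw [← hd, ← hd', this]
      · obtain ⟨p, hc, hr, hd⟩ := hp
        rw [(hf d).1 p hc hr hd, (hf d').2 hp'] at hdd
        exact (hp' ⟨θ p, (h p).1.trans hc, (h p).2.trans hr, hdd⟩).elim
      · obtain ⟨p, hc, hr, hd⟩ := hp'
        rw [(hf d').1 p hc hr hd, (hf d).2 hp] at hdd
        exact (hp ⟨θ p, (h p).1.trans hc, (h p).2.trans hr, hdd.symm⟩).elim
      · rwa [(hf d).2 hp, (hf d').2 hp'] at hdd
    exact ⟨Equiv.ofBijective f (Finite.injective_iff_bijective.1 hinj), hf⟩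
  choose s hs using hex
  refine ⟨s, fun r => ⟨(hs 0 r 0).2 ?_, (hs _ r 2).2 ?_⟩, fun p =>
    ⟨(h p).1, (h p).2, ((hs _ _ _).1 p rfl rfl rfl).symm⟩⟩
  · rw [exists_coord]; simp
  · rw [exists_coord]; simp

theorem Represents.isRefinement_iff {s : Fin (m + 1) → Column} {θ : Perm (LadderPoint m)}
    (hs : FixesEnds s) (h : Represents s θ) :
    IsRefinement θ (ladderMap m).σ ↔ ∀ i r, s i r ≠ (vertexRotation r)⁻¹ := by
  rw [_root_.isRefinement_iff card_vertex_le]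
  have key : ∀ p : LadderPoint m,
      (Nat.card {q // (ladderMap m).σ.SameCycle p q} = 3 ∧
        ∀ q, (ladderMap m).σ.SameCycle p q → θ q = (ladderMap m).σ⁻¹ q) ↔
      s p.col p.row = (vertexRotation p.row)⁻¹ := by
    intro p
    rw [card_vertex_eq_three_iff]
    constructor
    · rintro ⟨⟨h0, hm⟩, hθ⟩
      refine eq_inv_of_mul_eq_one_right (Perm.ext fun d => ?_)
      obtain ⟨q, hc, hr, rfl⟩ := (exists_coord p.col p.row d).2 ⟨fun _ => h0, fun _ => hm⟩
      have hq := hθ q ((sameCycle_ladderMap_σ _ _).2 ⟨hc.symm, hr.symm⟩)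
      rw [Perm.eq_inv_iff_eq] at hq
      have hd := dir_ladderMap_σ (θ q) (by rwa [(h q).1, hc]) (by rwa [(h q).1, hc])
      rw [hq, (h q).2.2, (h q).2.1, hc, hr] at hd
      exact hd.symm
    · intro hrot
      -- The inverse rotation fixes neither horizontal direction, so it cannot occur in an end
      -- column. The exclusion can thus be stated uniformly for all columns.
      have hrot0 : ∀ r, (vertexRotation r)⁻¹ 0 ≠ 0 ∧ (vertexRotation r)⁻¹ 2 ≠ 2 := by decide
      have h0 : p.col ≠ 0 := fun hc => (hrot0 p.row).1 (by rw [← hrot, hc, (hs _).1])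
      have hm : p.col ≠ Fin.last m := fun hc => (hrot0 p.row).2 (by rw [← hrot, hc, (hs _).2])
      refine ⟨⟨h0, hm⟩, fun q hq => ?_⟩
      obtain ⟨hc, hr⟩ := (sameCycle_ladderMap_σ _ _).1 hq
      rw [Perm.eq_inv_iff_eq]
      refine ext_coord ?_ ?_ ?_
      · rw [col_ladderMap_σ, (h q).1]
      · rw [row_ladderMap_σ, (h q).2.1]
      · rw [dir_ladderMap_σ _ (by rwa [(h q).1, ← hc]) (by rwa [(h q).1, ← hc]), (h q).2.2,
          (h q).2.1, ← hc, ← hr, hrot]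
        simp
  constructor
  · intro hr i r
    have := (hr (vert i r)).2
    rwa [key] at this
  · intro hr p
    refine ⟨(sameCycle_ladderMap_σ _ _).2 ⟨(h p).1.symm, (h p).2.1.symm⟩, ?_⟩
    rw [key]
    exact hr _ _

theorem exists_represents_of_isRefinement {θ : Perm (LadderPoint m)}
    (h : IsRefinement θ (ladderMap m).σ) : ∃ s, FixesEnds s ∧ Represents s θ := by
  rw [_root_.isRefinement_iff card_vertex_le] at h
  refine exists_represents_of_forall fun p => ?_
  have := (sameCycle_ladderMap_σ _ _).1 (h p).1
  exact ⟨this.1.symm, this.2.symm⟩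

theorem Represents.pow {s : Fin (m + 1) → Column} {θ : Perm (LadderPoint m)}
    (h : Represents s θ) (k : ℕ) (p : LadderPoint m) :
    ((θ ^ k) p).col = p.col ∧ ((θ ^ k) p).row = p.row ∧
      ((θ ^ k) p).dir = (s p.col p.row ^ k) p.dir := by
  induction k with
  | zero => simp
  | succ k ih =>
    rw [pow_succ', pow_succ', Perm.mul_apply, Perm.mul_apply]
    obtain ⟨hc, hr, hd⟩ := h ((θ ^ k) p)
    rw [hc, hr, hd, ih.1, ih.2.1, ih.2.2]
    exact ⟨rfl, rfl, rfl⟩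

/-- The direction `d` is the smallest one in its cycle. -/
def IsLeastInCycle (s : Perm (Fin 3)) (d : Fin 3) : Prop := ∀ e, s.SameCycle d e → d ≤ e

theorem Represents.forall_sameCycle_iff {s : Fin (m + 1) → Column} {θ : Perm (LadderPoint m)}
    (h : Represents s θ) (p : LadderPoint m) :
    (∀ q, θ.SameCycle p q → p.dir ≤ q.dir) ↔ IsLeastInCycle (s p.col p.row) p.dir := by
  constructor
  · intro hp e he
    obtain ⟨k, rfl⟩ := he.exists_nat_pow_eq
    rw [← (h.pow k p).2.2]
    exact hp _ ⟨k, by simp⟩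
  · intro hp q hq
    obtain ⟨k, rfl⟩ := hq.exists_nat_pow_eq
    rw [(h.pow k p).2.2]
    exact hp _ ⟨k, by simp⟩

theorem Represents.eq_of_sameCycle {s : Fin (m + 1) → Column} {θ : Perm (LadderPoint m)}
    (h : Represents s θ) {p q : LadderPoint m} (hpq : θ.SameCycle p q) (hd : p.dir = q.dir) :
    p = q := by
  obtain ⟨k, rfl⟩ := hpq.exists_nat_pow_eq
  exact ext_coord (h.pow k p).1.symm (h.pow k p).2.1.symm hd

/-- The number of cycles in a column. -/
def columnCycles (c : Column) : ℕ := countCycles (c true) + countCycles (c false)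

/-- The four extra cycles are the fixed missing directions: left in the first column and right in
the last, in both rows. This also holds for `m = 0`, where the two columns coincide. -/
theorem Represents.numCycles_add_four {s : Fin (m + 1) → Column} {θ : Perm (LadderPoint m)}
    (hs : FixesEnds s) (h : Represents s θ) :
    numCycles θ + 4 = ∑ i, columnCycles (s i) := by
  classical
  have hleft : numCycles θ = Nat.card {p : LadderPoint m // IsLeastInCycle (s p.col p.row) p.dir} := by
    rw [numCycles_eq_card_minimal θ dir fun p q => h.eq_of_sameCycle]
    simp only [h.forall_sameCycle_iff]
  have hright : Nat.card (Σ v : Fin (m + 1) × Bool, {d // IsLeastInCycle (s v.1 v.2) d}) =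
      ∑ i, columnCycles (s i) := by
    rw [Nat.card_sigma, Fintype.sum_prod_type]
    refine Finset.sum_congr rfl fun i _ => ?_
    rw [Fintype.sum_bool, columnCycles]
    simp only [countCycles, Nat.card_eq_fintype_card, Fintype.card_subtype, IsLeastInCycle]
  have hfix : ∀ (s : Perm (Fin 3)) (d : Fin 3), s d = d → IsLeastInCycle s d := fun s d hd e he =>
    (he.eq_of_left hd).le
  rw [hleft, ← hright, show 4 = Nat.card (Bool × Bool) by simp, ← Nat.card_sum]
  let F : {p : LadderPoint m // IsLeastInCycle (s p.col p.row) p.dir} ⊕ (Bool × Bool) →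
      (Σ v : Fin (m + 1) × Bool, {d // IsLeastInCycle (s v.1 v.2) d})
    | .inl p => ⟨(p.1.col, p.1.row), p.1.dir, p.2⟩
    | .inr (true, r) => ⟨(0, r), 0, hfix _ _ (hs r).1⟩
    | .inr (false, r) => ⟨(Fin.last m, r), 2, hfix _ _ (hs r).2⟩
  have hF : ∀ a b, F a = F b → (F a).1.1 = (F b).1.1 ∧ (F a).1.2 = (F b).1.2 ∧
      (F a).2.1 = (F b).2.1 := fun a b hab => by rw [hab]; exact ⟨rfl, rfl, rfl⟩
  refine Nat.card_eq_of_bijective F ⟨?_, ?_⟩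
  · rintro (p | ⟨b, r⟩) (q | ⟨b', r'⟩) hab
    · obtain ⟨hc, hr, hd⟩ := hF (.inl p) (.inl q) hab
      exact congrArg _ (Subtype.ext (ext_coord hc hr hd))
    · obtain ⟨hc, hr, hd⟩ := hF (.inl p) (.inr (b', r')) hab
      have := (exists_coord _ _ _).1 ⟨p.1, hc, hr, hd⟩
      cases b' <;> simp [F] at this
    · obtain ⟨hc, hr, hd⟩ := hF (.inl q) (.inr (b, r)) hab.symm
      have := (exists_coord _ _ _).1 ⟨q.1, hc, hr, hd⟩
      cases b <;> simp [F] at this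
    · obtain ⟨hc, hr, hd⟩ := hF (.inr (b, r)) (.inr (b', r')) hab
      cases b <;> cases b' <;> simp_all [F]
  · rintro ⟨⟨i, r⟩, d, hd⟩
    by_cases hp : ∃ p : LadderPoint m, p.col = i ∧ p.row = r ∧ p.dir = d
    · obtain ⟨p, rfl, rfl, rfl⟩ := hp
      exact ⟨.inl ⟨p, hd⟩, rfl⟩
    · rw [exists_coord] at hp
      by_cases h0 : d = 0 ∧ i = 0
      · obtain ⟨rfl, rfl⟩ := h0
        exact ⟨.inr (true, r), rfl⟩
      · obtain ⟨rfl, rfl⟩ : d = 2 ∧ i = Fin.last m := by tauto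
        exact ⟨.inr (false, r), rfl⟩

theorem Represents.isHypermap_iff {s : Fin (m + 1) → Column} {θ : Perm (LadderPoint m)}
    (hs : FixesEnds s) (h : Represents s θ) :
    (HypermapCollection.mk (ladderMap m).α θ).IsHypermap ↔ ConnectedColumns s := by
  rw [HypermapCollection.isHypermap_iff]
  constructor
  · intro hc e v hev
    let f : LadderPoint m → Bool
      | vert i _ => v i
      | right i r => e r (i + 1)
      | left i r => e r (i + 1)
    have hf : ∀ p : LadderPoint m, f p =
        ![e p.row p.col, v p.col, e p.row (p.col + 1)] p.dir := by
      intro p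
      cases p <;> simp [f, col, row, dir]
    have hconst := hc f (fun p => by cases p <;> rfl) (fun p => by
      rw [hf, hf, (h p).1, (h p).2.1, (h p).2.2]
      exact hev p.col p.row p.dir)
    refine ⟨fun i hi => ?_, fun i r h1 hi => ?_⟩
    · exact hconst (vert ⟨i, by omega⟩ true) (vert 0 true)
    · obtain ⟨j, rfl⟩ : ∃ j, i = j + 1 := ⟨i - 1, by omega⟩
      exact hconst (right ⟨j, by omega⟩ r) (vert 0 true)
  · intro hc f hα hθ
    -- The value `false` outside the ladder is harmless: it colours only missing directions, which
    -- are fixed.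
    let e : Bool → ℕ → Bool := fun r i =>
      if hi : 1 ≤ i ∧ i ≤ m then f (right ⟨i - 1, by omega⟩ r) else false
    let v : ℕ → Bool := fun i => if hi : i ≤ m then f (vert ⟨i, by omega⟩ true) else false
    have hvert : ∀ i, f (vert i true) = f (vert i false) := fun i => hα (vert i false)
    have hleft : ∀ i r, f (left i r) = f (right i r) := fun i r => hα (right i r)
    have hf : ∀ p : LadderPoint m, f p =
        ![e p.row p.col, v p.col, e p.row (p.col + 1)] p.dir := by
      intro p
      rcases p with ⟨i, r⟩ | ⟨i, r⟩ | ⟨i, r⟩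
      · have : (i : ℕ) ≤ m := by omega
        cases r <;> simp [v, col, dir, this, hvert]
      · simp [e, col, row, dir, Nat.succ_le_of_lt i.2]
      · simp [e, col, row, dir, Nat.succ_le_of_lt i.2, hleft]
    have hev : Compatible s e v := by
      intro i r d
      by_cases hp : ∃ p : LadderPoint m, p.col = i ∧ p.row = r ∧ p.dir = d
      · obtain ⟨p, rfl, rfl, rfl⟩ := hp
        have := hθ p
        rwa [hf, hf p, (h p).1, (h p).2.1, (h p).2.2] at this
      · rw [hs.apply_eq_self hp]
    obtain ⟨h1, h2⟩ := hc e v hev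
    have hall : ∀ p, f p = v 0 := by
      intro p
      rw [hf]
      rcases p with ⟨i, r⟩ | ⟨i, r⟩ | ⟨i, r⟩
      · exact h1 i (by omega)
      · exact h2 _ _ (by omega) (by simp [col])
      · exact h2 _ _ (by simp [col]) (by simp [col])
    exact fun p q => (hall p).trans (hall q).symm

/-- The local descriptions of the spanning hypertrees of the reciprocal of the ladder map. -/
def IsTreeColumns (s : Fin (m + 1) → Column) : Prop :=
  FixesEnds s ∧ (∀ i r, s i r ≠ (vertexRotation r)⁻¹) ∧ ConnectedColumns s ∧
    ∑ i, columnCycles (s i) = 3 * m + 6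

/-- With `6m + 2` points and `3m + 1` edges, a tree needs `z(θ) = 3m + 2`; the four missing
directions raise this to `3m + 6`. -/
theorem Represents.isSpanningHypertree_iff {s : Fin (m + 1) → Column} {θ : Perm (LadderPoint m)}
    (hs : FixesEnds s) (h : Represents s θ) :
    (ladderMap m).reciprocal.IsSpanningHypertree θ ↔ IsTreeColumns s := by
  have hz := h.numCycles_add_four hs
  rw [HypermapCollection.IsSpanningHypertree,
    HypermapCollection.isHypermap_and_numFaces_and_genus_iff]
  change IsRefinement θ (ladderMap m).σ ∧
    (HypermapCollection.mk (ladderMap m).α θ).IsHypermap ∧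
      numCycles θ + numCycles (ladderMap m).α = _ ↔ _
  rw [h.isRefinement_iff hs, h.isHypermap_iff hs, numCycles_ladderMap_α, card_eq, IsTreeColumns,
    ← hz]
  have : numCycles θ + (3 * m + 1) = 6 * m + 2 + 1 ↔ numCycles θ + 4 = 3 * m + 6 := by omega
  rw [this]
  tauto

theorem numSpanningHypertrees_eq (m : ℕ) :
    (ladderMap m).reciprocal.numSpanningHypertrees =
      Nat.card {s : Fin (m + 1) → Column // IsTreeColumns s} := by
  choose F hF using fun s : {s : Fin (m + 1) → Column // IsTreeColumns s} =>
    s.2.1.exists_represents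
  refine (Nat.card_eq_of_bijective
    (fun s => (⟨F s, ((hF s).isSpanningHypertree_iff s.2.1).2 s.2⟩ :
      {θ // (ladderMap m).reciprocal.IsSpanningHypertree θ})) ⟨?_, ?_⟩).symm
  · intro s s' hss
    have h1 := hF s
    rw [show F s = F s' from congrArg Subtype.val hss] at h1
    exact Subtype.ext (h1.unique_left s.2.1 s'.2.1 (hF s'))
  · rintro ⟨θ, hθ⟩
    obtain ⟨s, hs, h⟩ := exists_represents_of_isRefinement hθ.1
    have ht := (h.isSpanningHypertree_iff hs).1 hθ
    exact ⟨⟨s, ht⟩, Subtype.ext ((hF ⟨s, ht⟩).unique_right h)⟩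

/-! ### Links and the transfer of links across a column -/

/-- How the two horizontal edges that leave a part of the ladder are connected within that part. -/
inductive Link
  | joined
  | separate
  deriving DecidableEq

namespace Link

instance : Fintype Link := ⟨{joined, separate}, fun x => by cases x <;> decide⟩

theorem sum_univ {M : Type*} [AddCommMonoid M] (f : Link → M) :
    ∑ x, f x = f joined + f separate :=
  Finset.sum_pair (by decide)

/-- The pairs of colours of the two edges that leave the part extend to its edges. -/
def Allows : Link → Bool → Bool → Prop
  | joined, a, b => a = b
  | separate, _, _ => True

instance (x : Link) (a b : Bool) : Decidable (x.Allows a b) := by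
  cases x <;> unfold Allows <;> infer_instance

/-- The number of components of the part, minus one. -/
def excess : Link → ℕ
  | joined => 0
  | separate => 1

end Link

section Transfer

/-- The colourings of the edges at a column that respect it and are allowed to the left of it. -/
def LocalColouring (x : Link) (c : Column) (a b v a' b' : Bool) : Prop :=
  x.Allows a b ∧ Respects (c true) a v a' ∧ Respects (c false) b v b'

instance (x : Link) (c : Column) (a b v a' b' : Bool) :
    Decidable (LocalColouring x c a b v a' b') :=
  inferInstanceAs (Decidable (_ ∧ _))

/-- Appending a column to a part with link `x` yields a part with link `y`. -/
def Transfers (x : Link) (c : Column) (y : Link) : Prop :=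
  (∀ a b v a' b', LocalColouring x c a b v a' b' →
    y.Allows a' b' ∧ (a' = b' → v = a' ∧ a = a' ∧ b = a')) ∧
  ∀ a' b', y.Allows a' b' → ∃ a b v, LocalColouring x c a b v a' b'

instance (x : Link) (c : Column) (y : Link) : Decidable (Transfers x c y) :=
  inferInstanceAs (Decidable (_ ∧ _))

/-- A first column, with its directions to the left ignored, is a part with link `y`. -/
def Starts (c : Column) (y : Link) : Prop :=
  (∀ v a' b', LocalColouring .separate c a' b' v a' b' →
    y.Allows a' b' ∧ (a' = b' → v = a')) ∧
  ∀ a' b', y.Allows a' b' → ∃ v, LocalColouring .separate c a' b' v a' b'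

instance (c : Column) (y : Link) : Decidable (Starts c y) :=
  inferInstanceAs (Decidable (_ ∧ _))

/-- A last column connects everything to its left. -/
def Finishes (x : Link) (c : Column) : Prop :=
  ∀ a b v, LocalColouring x c a b v a b → a = v ∧ b = v

instance (x : Link) (c : Column) : Decidable (Finishes x c) :=
  inferInstanceAs (Decidable (∀ _, _))

/-- Either every component reaches an edge leaving to the right, and then a link describes the
result, or some component is cut off and can be coloured `false` while both leaving edges are
`true`. -/
theorem transfers_or (x : Link) (c : Column) : (∃ y, Transfers x c y) ∨
    ∃ a b v, LocalColouring x c a b v true true ∧ ¬ (v = true ∧ a = true ∧ b = true) := by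
  revert x c; decide +kernel

theorem starts_or (c : Column) (h : ∀ r, c r 0 = 0) : (∃ y, Starts c y) ∨
    ∃ v, LocalColouring .separate c true true v true true ∧ v ≠ true := by
  revert c; decide +kernel

/-- Euler characteristic of the incidence graph: a column brings six points and three new edges, so
its cycles number at most `6 - 3` plus the change in the number of components, with equality when no
circuit is closed. The bounds for first and last columns arise likewise, with two missing directions
counted as cycles. -/
theorem transfers_columnCycles_le (x : Link) (c : Column) (y : Link) (h : Transfers x c y) :
    columnCycles c + x.excess ≤ 3 + y.excess := by
  revert x c y; decide +kernel

theorem starts_columnCycles_le (c : Column) (y : Link) (h : Starts c y) (h0 : ∀ r, c r 0 = 0) :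
    columnCycles c ≤ 4 + y.excess := by
  revert c y; decide +kernel

theorem finishes_columnCycles_le (x : Link) (c : Column) (h : Finishes x c)
    (h2 : ∀ r, c r 2 = 2) : columnCycles c + x.excess ≤ 5 := by
  revert x c; decide +kernel

end Transfer

/-! ### Gluing colourings along initial parts of the ladder -/

section Parts

variable {k : ℕ}

/-- The columns `s` together with a further column `c` on their right. -/
abbrev appendColumn (s : Fin (k + 1) → Column) (c : Column) : Fin (k + 1 + 1) → Column :=
  Fin.snoc (α := fun _ => Column) s c

theorem compatible_appendColumn {s : Fin (k + 1) → Column} {c : Column} {e : Bool → ℕ → Bool}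
    {v : ℕ → Bool} : Compatible (appendColumn s c) e v ↔ Compatible s e v ∧
      ∀ r, Respects (c r) (e r (k + 1)) (v (k + 1)) (e r (k + 2)) := by
  rw [Compatible, Fin.forall_fin_succ']
  simp [Compatible]

theorem Compatible.congr {s : Fin (k + 1) → Column} {e e' : Bool → ℕ → Bool} {v v' : ℕ → Bool}
    (h : Compatible s e v) (he : ∀ r, ∀ i ≤ k + 1, e' r i = e r i) (hv : ∀ i ≤ k, v' i = v i) :
    Compatible s e' v' := by
  intro i r
  rw [he r i (by omega), he r (i + 1) (by omega), hv i (by omega)]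
  exact h i r

theorem Compatible.exists_append {s : Fin (k + 1) → Column} {c : Column} {e : Bool → ℕ → Bool}
    {v : ℕ → Bool} (h : Compatible s e v) {w a b : Bool}
    (ha : Respects (c true) (e true (k + 1)) w a) (hb : Respects (c false) (e false (k + 1)) w b) :
    ∃ e' v', Compatible (appendColumn s c) e' v' ∧ (∀ r, ∀ i ≤ k + 1, e' r i = e r i) ∧
      (∀ i ≤ k, v' i = v i) ∧ v' (k + 1) = w ∧ e' true (k + 2) = a ∧ e' false (k + 2) = b := by
  let eNew : Bool → ℕ → Bool := fun r i =>
    if i = k + 2 then (if r then a else b) else e r i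
  let vNew : ℕ → Bool := fun i => if i = k + 1 then w else v i
  have he : ∀ r, ∀ i ≤ k + 1, eNew r i = e r i := fun r i hi => by
    simp only [eNew, if_neg (show i ≠ k + 2 by omega)]
  have hv : ∀ i ≤ k, vNew i = v i := fun i hi => by
    simp only [vNew, if_neg (show i ≠ k + 1 by omega)]
  refine ⟨eNew, vNew, compatible_appendColumn.2 ⟨h.congr he hv, ?_⟩, he, hv, by simp [vNew],
    by simp [eNew], by simp [eNew]⟩
  rintro (_ | _)
  · simpa [he, vNew, eNew] using hb
  · simpa [he, vNew, eNew] using ha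

/-- All edges of the columns `0, …, k`, including those that leave them to the right, have
colour `a`. -/
def IsMonochromatic (k : ℕ) (e : Bool → ℕ → Bool) (v : ℕ → Bool) (a : Bool) : Prop :=
  ∀ i ≤ k, v i = a ∧ ∀ r, e r (i + 1) = a

theorem IsMonochromatic.succ_iff {e : Bool → ℕ → Bool} {v : ℕ → Bool} {a : Bool} :
    IsMonochromatic (k + 1) e v a ↔
      IsMonochromatic k e v a ∧ v (k + 1) = a ∧ ∀ r, e r (k + 2) = a := by
  constructor
  · exact fun h => ⟨fun i hi => h i (by omega), h (k + 1) le_rfl⟩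
  · rintro ⟨h, h'⟩ i hi
    rcases Nat.lt_or_ge k i with hk | hk
    · obtain rfl : i = k + 1 := by omega
      exact h'
    · exact h i hk

/-- The link between the edges that leave the columns to the right is `y`, and every edge is
connected to one of them. -/
def IsPart (s : Fin (k + 1) → Column) (y : Link) : Prop :=
  (∀ e v, Compatible s e v → y.Allows (e true (k + 1)) (e false (k + 1)) ∧
    (e true (k + 1) = e false (k + 1) → IsMonochromatic k e v (e true (k + 1)))) ∧
  ∀ a b, y.Allows a b → ∃ e v, Compatible s e v ∧ e true (k + 1) = a ∧ e false (k + 1) = b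

/-- Some edge is not connected to those that leave the columns to the right. -/
def HasDetachedEdge (s : Fin (k + 1) → Column) : Prop :=
  ∃ e v, Compatible s e v ∧ e true (k + 1) = true ∧ e false (k + 1) = true ∧
    ¬ IsMonochromatic k e v true

theorem respects_const (s : Perm (Fin 3)) (a : Bool) : Respects s a a a := by
  have : ∀ d : Fin 3, ![a, a, a] d = a := by intro d; fin_cases d <;> rfl
  exact fun d => by rw [this, this]

theorem IsPart.not_hasDetachedEdge {s : Fin (k + 1) → Column} {y : Link} (h : IsPart s y) :
    ¬ HasDetachedEdge s := by
  rintro ⟨e, v, hc, ht, hb, hn⟩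
  have := (h.1 e v hc).2 (ht.trans hb.symm)
  rw [ht] at this
  exact hn this

/-- Giving the two leaving edges different colours is possible exactly when they are separate. -/
theorem IsPart.unique {s : Fin (k + 1) → Column} {y y' : Link} (h : IsPart s y)
    (h' : IsPart s y') : y = y' := by
  have key : ∀ y y' : Link, IsPart s y → IsPart s y' → y.Allows true false →
      y'.Allows true false := by
    intro y y' h h' hy
    obtain ⟨e, v, hc, ht, hb⟩ := h.2 _ _ hy
    have := (h'.1 e v hc).1
    rwa [ht, hb] at this
  have h1 := key y y' h h'
  have h2 := key y' y h' h
  cases y <;> cases y' <;> simp_all [Link.Allows]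

/-- A component cut off from the right stays so: the new column is coloured `true` throughout. -/
theorem HasDetachedEdge.append {s : Fin (k + 1) → Column} (h : HasDetachedEdge s) (c : Column) :
    HasDetachedEdge (appendColumn s c) := by
  obtain ⟨e, v, hc, ht, hb, hn⟩ := h
  obtain ⟨e', v', hc', he, hv, -, ht', hb'⟩ := hc.exists_append (c := c) (w := true) (a := true)
    (b := true) (by rw [ht]; exact respects_const _ _) (by rw [hb]; exact respects_const _ _)
  refine ⟨e', v', hc', ht', hb', fun hm => hn fun i hi => ?_⟩
  have := hm i (by omega)
  rw [hv i hi] at this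
  exact ⟨this.1, fun r => by rw [← he r _ (by omega), this.2]⟩

theorem IsPart.append {s : Fin (k + 1) → Column} {x y : Link} {c : Column} (h : IsPart s x)
    (hc : Transfers x c y) : IsPart (appendColumn s c) y := by
  constructor
  · intro e v hev
    obtain ⟨hs, hr⟩ := compatible_appendColumn.1 hev
    obtain ⟨h1, h2⟩ := h.1 e v hs
    obtain ⟨h3, h4⟩ := hc.1 _ _ _ _ _ ⟨h1, hr true, hr false⟩
    refine ⟨h3, fun heq => ?_⟩
    obtain ⟨hv, ha, hb⟩ := h4 heq
    rw [IsMonochromatic.succ_iff]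
    refine ⟨?_, hv, ?_⟩
    · have := h2 (ha.trans hb.symm)
      rwa [ha] at this
    · rintro (_ | _)
      · exact heq.symm
      · rfl
  · intro a' b' hab
    obtain ⟨a, b, w, hl, ha, hb⟩ := hc.2 a' b' hab
    obtain ⟨e, v, hs, rfl, rfl⟩ := h.2 a b hl
    obtain ⟨e', v', hc', -, -, -, ht', hb'⟩ := hs.exists_append ha hb
    exact ⟨e', v', hc', ht', hb'⟩

theorem IsPart.append_or {s : Fin (k + 1) → Column} {x : Link} (h : IsPart s x) (c : Column) :
    (∃ y, Transfers x c y) ∨ HasDetachedEdge (appendColumn s c) := by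
  refine (transfers_or x c).imp_right ?_
  rintro ⟨a, b, w, ⟨hl, ha, hb⟩, hn⟩
  obtain ⟨e, v, hs, rfl, rfl⟩ := h.2 a b hl
  obtain ⟨e', v', hc', he, -, hw, ht', hb'⟩ := hs.exists_append ha hb
  refine ⟨e', v', hc', ht', hb', fun hm => hn ⟨?_, ?_, ?_⟩⟩
  · rw [← hw, (hm (k + 1) le_rfl).1]
  · rw [← he _ _ le_rfl, (hm k (by omega)).2]
  · rw [← he _ _ le_rfl, (hm k (by omega)).2]

/-- The left directions are fixed, so their colours are arbitrary and may be replaced by those on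
the right. -/
theorem Compatible.localColouring {c : Column} {e : Bool → ℕ → Bool} {v : ℕ → Bool}
    (h0 : ∀ r, c r 0 = 0) (h : Compatible (m := 0) (fun _ => c) e v) :
    LocalColouring .separate c (e true 1) (e false 1) (v 0) (e true 1) (e false 1) := by
  have key : ∀ (s : Perm (Fin 3)) (a w b : Bool), s 0 = 0 → Respects s a w b →
      Respects s b w b := by decide +kernel
  exact ⟨trivial, key _ _ _ _ (h0 true) (h 0 true), key _ _ _ _ (h0 false) (h 0 false)⟩

theorem LocalColouring.exists_compatible {x : Link} {c : Column} {a b w : Bool}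
    (h : LocalColouring x c a b w a b) :
    ∃ e v, Compatible (m := 0) (fun _ => c) e v ∧ e true 1 = a ∧ e false 1 = b ∧ v 0 = w := by
  refine ⟨fun r _ => if r then a else b, fun _ => w, ?_, rfl, rfl, rfl⟩
  rintro i (_ | _)
  · exact h.2.2
  · exact h.2.1

theorem isPart_of_starts {c : Column} (h0 : ∀ r, c r 0 = 0) {y : Link} (h : Starts c y) :
    IsPart (k := 0) (fun _ => c) y := by
  constructor
  · intro e v hc
    obtain ⟨h1, h2⟩ := h.1 _ _ _ (hc.localColouring h0)
    refine ⟨h1, fun heq i hi => ?_⟩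
    obtain rfl : i = 0 := by omega
    refine ⟨h2 heq, ?_⟩
    rintro (_ | _)
    · exact heq.symm
    · rfl
  · intro a b hab
    obtain ⟨w, hw⟩ := h.2 a b hab
    obtain ⟨e, v, hc, ht, hb, -⟩ := hw.exists_compatible
    exact ⟨e, v, hc, ht, hb⟩

theorem starts_or_hasDetachedEdge {c : Column} (h0 : ∀ r, c r 0 = 0) :
    (∃ y, Starts c y) ∨ HasDetachedEdge (k := 0) (fun _ => c) := by
  refine (starts_or c h0).imp_right ?_
  rintro ⟨w, hw, hn⟩
  obtain ⟨e, v, hc, ht, hb, hv⟩ := hw.exists_compatible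
  exact ⟨e, v, hc, ht, hb, fun hm => hn (by rw [← hv, (hm 0 le_rfl).1])⟩

theorem isPart_zero_iff {c : Column} (h0 : ∀ r, c r 0 = 0) (y : Link) :
    IsPart (k := 0) (fun _ => c) y ↔ Starts c y := by
  refine ⟨fun h => ?_, isPart_of_starts h0⟩
  rcases starts_or_hasDetachedEdge h0 with ⟨y', hy'⟩ | hd
  · rwa [h.unique (isPart_of_starts h0 hy')]
  · exact (h.not_hasDetachedEdge hd).elim

theorem eq_const_of_fin_one {Y : Type*} (s : Fin (0 + 1) → Y) : s = fun _ => s 0 :=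
  funext fun i => congrArg s (Fin.ext (by omega))

theorem appendColumn_zero (s : Fin (k + 1) → Column) (c : Column) : appendColumn s c 0 = s 0 :=
  Fin.snoc_castSucc (α := fun _ => Column) c s 0

theorem exists_appendColumn (s : Fin (k + 1 + 1) → Column) : ∃ s' c, s = appendColumn s' c :=
  ⟨Fin.init s, s (Fin.last _), (Fin.snoc_init_self s).symm⟩

theorem appendColumn_injective {s s' : Fin (k + 1) → Column} {c c' : Column}
    (h : appendColumn s c = appendColumn s' c') : s = s' ∧ c = c' :=
  Fin.snoc_injective2 h

theorem isPart_or_hasDetachedEdge (s : Fin (k + 1) → Column) (h0 : ∀ r, s 0 r 0 = 0) :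
    (∃ y, IsPart s y) ∨ HasDetachedEdge s := by
  induction k with
  | zero =>
    rw [eq_const_of_fin_one s]
    exact (starts_or_hasDetachedEdge h0).imp_left fun ⟨y, hy⟩ => ⟨y, isPart_of_starts h0 hy⟩
  | succ k ih =>
    obtain ⟨s, c, rfl⟩ := exists_appendColumn s
    rw [appendColumn_zero] at h0
    rcases ih s h0 with ⟨x, hx⟩ | hd
    · exact (hx.append_or c).imp_left fun ⟨y, hy⟩ => ⟨y, hx.append hy⟩
    · exact .inr (hd.append c)

/-- A detached edge at either stage would survive in the whole, so the shorter sequence is a part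
and the column transfers its link; uniqueness identifies the resulting link with `y`. -/
theorem isPart_appendColumn_iff {s : Fin (k + 1) → Column} (h0 : ∀ r, s 0 r 0 = 0) (c : Column)
    (y : Link) : IsPart (appendColumn s c) y ↔ ∃ x, IsPart s x ∧ Transfers x c y := by
  refine ⟨fun h => ?_, fun ⟨x, hx, hy⟩ => hx.append hy⟩
  rcases isPart_or_hasDetachedEdge s h0 with ⟨x, hx⟩ | hd
  · rcases hx.append_or c with ⟨y', hy'⟩ | hd
    · obtain rfl := h.unique (hx.append hy')
      exact ⟨x, hx, hy'⟩
    · exact (h.not_hasDetachedEdge hd).elim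
  · exact (h.not_hasDetachedEdge (hd.append c)).elim

theorem IsPart.sum_columnCycles_le {s : Fin (k + 1) → Column} {y : Link} (h : IsPart s y)
    (h0 : ∀ r, s 0 r 0 = 0) : ∑ i, columnCycles (s i) ≤ 3 * k + 4 + y.excess := by
  induction k generalizing y with
  | zero =>
    rw [eq_const_of_fin_one s, isPart_zero_iff h0] at h
    simpa using starts_columnCycles_le _ _ h h0
  | succ k ih =>
    obtain ⟨s, c, rfl⟩ := exists_appendColumn s
    rw [appendColumn_zero] at h0
    obtain ⟨x, hx, hy⟩ := (isPart_appendColumn_iff h0 c y).1 h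
    have h1 := ih hx h0
    have h2 := transfers_columnCycles_le _ _ _ hy
    rw [Fin.sum_univ_castSucc]
    simp only [Fin.snoc_castSucc, Fin.snoc_last]
    omega

theorem connectedColumns_appendColumn_iff {s : Fin (k + 1) → Column} (h0 : ∀ r, s 0 r 0 = 0)
    {c : Column} (h2 : ∀ r, c r 2 = 2) :
    ConnectedColumns (appendColumn s c) ↔ ∃ x, IsPart s x ∧ Finishes x c := by
  have key : ∀ (s : Perm (Fin 3)) (a w b : Bool), s 2 = 2 → Respects s a w b →
      Respects s a w a := by decide +kernel
  constructor
  · intro h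
    rcases isPart_or_hasDetachedEdge s h0 with ⟨x, hx⟩ | ⟨e, v, hc, ht, hb, hn⟩
    · refine ⟨x, hx, fun a b w ⟨hl, ha, hb⟩ => ?_⟩
      obtain ⟨e, v, hs, rfl, rfl⟩ := hx.2 a b hl
      obtain ⟨e', v', hc', he, -, hw, -, -⟩ := hs.exists_append ha hb
      obtain ⟨h3, h4⟩ := h e' v' hc'
      rw [← hw, h3 (k + 1) le_rfl, ← he _ _ le_rfl, ← he _ _ le_rfl]
      exact ⟨h4 _ _ (by omega) le_rfl, h4 _ _ (by omega) le_rfl⟩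
    -- Colouring the last column `true` extends the detached colouring to the whole ladder, against
    -- connectedness.
    · refine (hn ?_).elim
      obtain ⟨e', v', hc', he, hv, hw, -, -⟩ := hc.exists_append (c := c) (w := true) (a := true)
        (b := true) (by rw [ht]; exact respects_const _ _) (by rw [hb]; exact respects_const _ _)
      obtain ⟨h3, h4⟩ := h e' v' hc'
      have h5 : v' 0 = true := by rw [← hw, h3 (k + 1) le_rfl]
      refine fun i hi => ⟨?_, fun r => ?_⟩
      · rw [← hv i hi, h3 i (by omega), h5]
      · rw [← he r _ (by omega), h4 _ _ (by omega) (by omega), h5]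
  · rintro ⟨x, hx, hf⟩ e v hev
    obtain ⟨hs, hr⟩ := compatible_appendColumn.1 hev
    obtain ⟨hl, hm⟩ := hx.1 e v hs
    obtain ⟨ha, hb⟩ := hf _ _ _
      ⟨hl, key _ _ _ _ (h2 true) (hr true), key _ _ _ _ (h2 false) (hr false)⟩
    have hmono := hm (ha.trans hb.symm)
    have hv0 : v 0 = e true (k + 1) := (hmono 0 (by omega)).1
    refine ⟨fun i hi => ?_, fun i r h1 hi => ?_⟩
    · rw [hv0]
      rcases Nat.lt_or_ge k i with hk | hk
      · obtain rfl : i = k + 1 := by omega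
        exact ha.symm
      · exact (hmono i hk).1
    · obtain ⟨j, rfl⟩ : ∃ j, i = j + 1 := ⟨i - 1, by omega⟩
      rw [hv0]
      exact (hmono j (by omega)).2 r

end Parts

/-! ### Transfer matrix for forests -/

section Counting

variable {k : ℕ}

/-- The permutations at the vertices of the column are refinements of the rotations. -/
def IsAdmissible (c : Column) : Prop := ∀ r, c r ≠ (vertexRotation r)⁻¹

instance (c : Column) : Decidable (IsAdmissible c) := inferInstanceAs (Decidable (∀ _, _))

/-- The first columns of a tree: they form a part of link `y` without circuits. -/
def IsForest (s : Fin (k + 1) → Column) (y : Link) : Prop :=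
  (∀ r, s 0 r 0 = 0) ∧ (∀ i, IsAdmissible (s i)) ∧ IsPart s y ∧
    ∑ i, columnCycles (s i) = 3 * k + 4 + y.excess

/-- A column that turns a forest of link `x` into one of link `y`. -/
def ExtendsForest (x y : Link) (c : Column) : Prop :=
  IsAdmissible c ∧ Transfers x c y ∧ columnCycles c + x.excess = 3 + y.excess

instance (x y : Link) (c : Column) : Decidable (ExtendsForest x y c) :=
  inferInstanceAs (Decidable (_ ∧ _))

/-- A column that turns a forest of link `x` into a tree. -/
def CompletesForest (x : Link) (c : Column) : Prop :=
  IsAdmissible c ∧ (∀ r, c r 2 = 2) ∧ Finishes x c ∧ columnCycles c + x.excess = 5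

instance (x : Link) (c : Column) : Decidable (CompletesForest x c) :=
  inferInstanceAs (Decidable (_ ∧ _))

theorem sum_columnCycles_appendColumn (s : Fin (k + 1) → Column) (c : Column) :
    ∑ i, columnCycles (appendColumn s c i) = (∑ i, columnCycles (s i)) + columnCycles c := by
  rw [Fin.sum_univ_castSucc]
  simp only [Fin.snoc_castSucc, Fin.snoc_last]

theorem forall_isAdmissible_appendColumn (s : Fin (k + 1) → Column) (c : Column) :
    (∀ i, IsAdmissible (appendColumn s c i)) ↔ (∀ i, IsAdmissible (s i)) ∧ IsAdmissible c := by
  rw [Fin.forall_fin_succ']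
  simp only [Fin.snoc_castSucc, Fin.snoc_last]

/-- The bounds for the shorter part and for the column add up to the bound for the whole. Equality
in the sum therefore forces equality in each. -/
theorem isForest_appendColumn_iff (s : Fin (k + 1) → Column) (c : Column) (y : Link) :
    IsForest (appendColumn s c) y ↔ ∃ x, IsForest s x ∧ ExtendsForest x y c := by
  simp only [IsForest, appendColumn_zero, forall_isAdmissible_appendColumn,
    sum_columnCycles_appendColumn]
  constructor
  · rintro ⟨h0, ⟨hs, hc⟩, hp, hsum⟩
    obtain ⟨x, hx, hy⟩ := (isPart_appendColumn_iff h0 c y).1 hp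
    have h1 := hx.sum_columnCycles_le h0
    have h2 := transfers_columnCycles_le _ _ _ hy
    exact ⟨x, ⟨h0, hs, hx, by omega⟩, hc, hy, by omega⟩
  · rintro ⟨x, ⟨h0, hs, hx, hsum⟩, hc, hy, hcyc⟩
    exact ⟨h0, ⟨hs, hc⟩, hx.append hy, by omega⟩

theorem isTreeColumns_appendColumn_iff (s : Fin (k + 1) → Column) (c : Column) :
    IsTreeColumns (appendColumn s c) ↔ ∃ x, IsForest s x ∧ CompletesForest x c := by
  have hadm : (∀ i r, appendColumn s c i r ≠ (vertexRotation r)⁻¹) ↔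
    (∀ i, IsAdmissible (s i)) ∧ IsAdmissible c := forall_isAdmissible_appendColumn s c
  have hfix : FixesEnds (appendColumn s c) ↔ (∀ r, s 0 r 0 = 0) ∧ ∀ r, c r 2 = 2 := by
    rw [FixesEnds, forall_and]
    simp only [appendColumn_zero, Fin.snoc_last]
  rw [IsTreeColumns, hadm, hfix, sum_columnCycles_appendColumn]
  constructor
  · rintro ⟨⟨h0, h2⟩, ⟨hs, hc⟩, hconn, hsum⟩
    obtain ⟨x, hx, hf⟩ := (connectedColumns_appendColumn_iff h0 h2).1 hconn
    have h3 := hx.sum_columnCycles_le h0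
    have h4 := finishes_columnCycles_le _ _ hf h2
    exact ⟨x, ⟨h0, hs, hx, by omega⟩, hc, h2, hf, by omega⟩
  · rintro ⟨x, ⟨h0, hs, hx, hsum⟩, hc, h2, hf, hcyc⟩
    exact ⟨⟨h0, h2⟩, ⟨hs, hc⟩, (connectedColumns_appendColumn_iff h0 h2).2 ⟨x, hx, hf⟩, by omega⟩

/-- A forest determines its link, so the cases of the two links are disjoint and the counts add. -/
theorem card_appendColumn {P : (Fin (k + 1 + 1) → Column) → Prop} {Q : Link → Column → Prop}
    (h : ∀ s c, P (appendColumn s c) ↔ ∃ x, IsForest s x ∧ Q x c) :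
    Nat.card {s // P s} =
      Nat.card {s : Fin (k + 1) → Column // IsForest s .joined} * Nat.card {c // Q .joined c} +
      Nat.card {s : Fin (k + 1) → Column // IsForest s .separate} *
        Nat.card {c // Q .separate c} := by
  rw [← Nat.card_prod, ← Nat.card_prod, ← Link.sum_univ fun x =>
    Nat.card ({s : Fin (k + 1) → Column // IsForest s x} × {c // Q x c}), ← Nat.card_sigma]
  refine (Nat.card_eq_of_bijective
    (fun z : Σ x, {s : Fin (k + 1) → Column // IsForest s x} × {c // Q x c} =>
      (⟨appendColumn z.2.1.1 z.2.2.1, (h _ _).2 ⟨z.1, z.2.1.2, z.2.2.2⟩⟩ : {s // P s}))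
    ⟨?_, ?_⟩).symm
  · rintro ⟨x, ⟨s, hs⟩, ⟨c, hc⟩⟩ ⟨x', ⟨s', hs'⟩, ⟨c', hc'⟩⟩ hz
    obtain ⟨h1, h2⟩ := appendColumn_injective (congrArg Subtype.val hz)
    dsimp only at h1 h2
    subst h1 h2
    obtain rfl := hs.2.2.1.unique hs'.2.2.1
    rfl
  · rintro ⟨s, hs⟩
    obtain ⟨s, c, rfl⟩ := exists_appendColumn s
    obtain ⟨x, hx, hc⟩ := (h s c).1 hs
    exact ⟨⟨x, ⟨s, hx⟩, ⟨c, hc⟩⟩, rfl⟩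

theorem card_extendsForest :
    Nat.card {c // ExtendsForest .joined .joined c} = 4 ∧
    Nat.card {c // ExtendsForest .joined .separate c} = 8 ∧
    Nat.card {c // ExtendsForest .separate .joined c} = 1 ∧
    Nat.card {c // ExtendsForest .separate .separate c} = 4 := by
  simp only [Nat.card_eq_fintype_card, Fintype.card_subtype]
  decide +kernel

theorem card_completesForest :
    Nat.card {c // CompletesForest .joined c} = 2 ∧
    Nat.card {c // CompletesForest .separate c} = 1 := by
  simp only [Nat.card_eq_fintype_card, Fintype.card_subtype]
  decide +kernel

/-- The number of forests of `k + 1` columns. -/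
noncomputable def numForests (k : ℕ) (y : Link) : ℕ :=
  Nat.card {s : Fin (k + 1) → Column // IsForest s y}

theorem numForests_succ_joined (k : ℕ) :
    numForests (k + 1) .joined = 4 * numForests k .joined + numForests k .separate := by
  rw [numForests, card_appendColumn fun s c => isForest_appendColumn_iff s c .joined,
    card_extendsForest.1, card_extendsForest.2.2.1, numForests, numForests]
  ring

theorem numForests_succ_separate (k : ℕ) :
    numForests (k + 1) .separate = 8 * numForests k .joined + 4 * numForests k .separate := by
  rw [numForests, card_appendColumn fun s c => isForest_appendColumn_iff s c .separate,
    card_extendsForest.2.1, card_extendsForest.2.2.2, numForests, numForests]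
  ring

theorem numForests_zero (y : Link) : numForests 0 y = 1 + y.excess := by
  let P : Column → Prop := fun c =>
    (∀ r, c r 0 = 0) ∧ IsAdmissible c ∧ Starts c y ∧ columnCycles c = 4 + y.excess
  have hP : ∀ s : Fin (0 + 1) → Column, IsForest s y ↔ P (s 0) := by
    intro s
    rw [eq_const_of_fin_one s]
    simp only [IsForest, P, Finset.sum_const, Finset.card_univ, Fintype.card_fin, zero_add,
      one_smul, mul_zero, forall_const]
    refine and_congr_right fun h0 => ?_
    rw [isPart_zero_iff h0]
  have : numForests 0 y = Nat.card {c // P c} :=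
    Nat.card_congr ((Equiv.funUnique (Fin 1) Column).subtypeEquiv fun s => hP s)
  rw [this]
  simp only [P, Nat.card_eq_fintype_card, Fintype.card_subtype]
  clear this hP P
  revert y
  decide +kernel

theorem numSpanningHypertrees_succ (k : ℕ) :
    (ladderMap (k + 1)).reciprocal.numSpanningHypertrees =
      2 * numForests k .joined + numForests k .separate := by
  rw [numSpanningHypertrees_eq, card_appendColumn fun s c => isTreeColumns_appendColumn_iff s c,
    card_completesForest.1, card_completesForest.2, numForests, numForests]
  ring

/-- The single column is both first and last, so it is not a forest followed by a last column.
Fixing both horizontal directions leaves only the identity. -/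
theorem numSpanningHypertrees_zero : (ladderMap 0).reciprocal.numSpanningHypertrees = 1 := by
  rw [numSpanningHypertrees_eq, Nat.card_eq_one_iff_unique]
  have hfix : ∀ π : Perm (Fin 3), π 0 = 0 → π 2 = 2 → π = 1 := by decide +kernel
  have huniq : ∀ s : Fin (0 + 1) → Column, FixesEnds s → s = fun _ _ => 1 := by
    intro s hs
    rw [eq_const_of_fin_one s]
    exact funext fun _ => funext fun r => hfix _ (hs r).1 (hs r).2
  refine ⟨⟨fun s s' => Subtype.ext ((huniq _ s.2.1).trans (huniq _ s'.2.1).symm)⟩,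
    ⟨⟨fun _ _ => 1, fun r => ⟨rfl, rfl⟩, fun _ r => ?_, fun e v _ => ⟨?_, ?_⟩, ?_⟩⟩⟩
  · have : ∀ r, 1 ≠ (vertexRotation r)⁻¹ := by decide +kernel
    exact this r
  · intro i hi
    rw [Nat.le_zero.1 hi]
  · intro i r h1 hi
    omega
  · decide +kernel

end Counting

/-! ### The generating function -/

theorem mainTheorem4 :
    PowerSeries.mk (fun m : ℕ => ((ladderMap m).reciprocal.numSpanningHypertrees : ℚ)) =
      (1 - 2 * PowerSeries.X) ^ 2 * (1 - 8 * PowerSeries.X + 8 * PowerSeries.X ^ 2)⁻¹ := by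
  set T : ℕ → ℚ := fun m => ((ladderMap m).reciprocal.numSpanningHypertrees : ℚ) with hT
  have h0 : T 0 = 1 := by simp [hT, numSpanningHypertrees_zero]
  have h1 : T 1 = 4 := by
    simp [hT, numSpanningHypertrees_succ 0, numForests_zero, Link.excess]
  have h2 : T 2 = 28 := by
    simp [hT, numSpanningHypertrees_succ 1, numForests_succ_joined 0, numForests_succ_separate 0,
      numForests_zero, Link.excess]
  -- This is the Cayley–Hamilton relation of the transfer matrix. It starts at `T 3` because `T 0`
  -- does not come from the matrix; the coefficients 1, -4, 4 of the numerator absorb the initial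
  -- values 1, 4, 28.
  have hrec : ∀ n, T (n + 3) = 8 * T (n + 2) - 8 * T (n + 1) := by
    intro n
    simp only [hT, numSpanningHypertrees_succ, numForests_succ_joined, numForests_succ_separate]
    push_cast
    ring
  rw [PowerSeries.eq_mul_inv_iff_mul_eq (by simp)]
  have c8 : PowerSeries.C (8 : ℚ) = 8 := map_ofNat _ 8
  have c4 : PowerSeries.C (4 : ℚ) = 4 := map_ofNat _ 4
  have e1 : (1 - 8 * PowerSeries.X + 8 * PowerSeries.X ^ 2 : PowerSeries ℚ) =
      1 - PowerSeries.C 8 * PowerSeries.X + PowerSeries.C 8 * PowerSeries.X ^ 2 := by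
    rw [c8]
  have e2 : ((1 - 2 * PowerSeries.X) ^ 2 : PowerSeries ℚ) =
      1 - PowerSeries.C 4 * PowerSeries.X + PowerSeries.C 4 * PowerSeries.X ^ 2 := by
    rw [c4]
    ring
  have e3 : PowerSeries.mk T *
      (1 - PowerSeries.C 8 * PowerSeries.X + PowerSeries.C 8 * PowerSeries.X ^ 2) =
      PowerSeries.mk T - PowerSeries.C 8 * (PowerSeries.mk T * PowerSeries.X) +
        PowerSeries.C 8 * (PowerSeries.mk T * PowerSeries.X ^ 2) := by ring
  rw [e1, e2, e3]
  ext n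
  rcases n with _ | _ | _ | n
  · simp [h0]
  · simp [h0, h1, PowerSeries.coeff_mul_X_pow', PowerSeries.coeff_one]
    norm_num
  · simp [h0, h1, h2, PowerSeries.coeff_mul_X_pow', PowerSeries.coeff_succ_mul_X,
      PowerSeries.coeff_one]
    norm_num
  · simp [hrec, PowerSeries.coeff_mul_X_pow', PowerSeries.coeff_succ_mul_X, PowerSeries.coeff_one]
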